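/- Consider the rectangular grid on $\mathbb{Z}^2$. A path on the grid is a simple path with two distinct endpoints in the graph on $\mathbb{Z}^2$ joining points at distance $1$; a bend of a path is a $90$-degree turn at a grid-point of the path. Two paths are interiorly disjoint if they share no grid-edge and every common grid-point is an endpoint of at least one of them; they touch if they have a common grid-point. For $k \ge 0$, a graph $G=(V,E)$ is $B_k$-CPG if there is a family $(P_v)_{v\in V}$ of pairwise interiorly disjoint paths on the grid, each with at most $k$ bends, such that distinct $u,v\in V$ are adjacent in $G$ if and only if $P_u$ and $P_v$ touch. For $k \ge 0$, let $G_k$ be the graph with vertices $a$, $b$, secondary vertices $\alpha_1,\dots,\alpha_{20}$, and sewing vertices $u^i_1,\dots,u^i_{k+2}$ for $1\le i\le 19$, and with exactly the following edges: $ab$; $a\alpha_i$ and $b\alpha_i$ for $1\le i\le 20$; $u^i_j\alpha_i$ and $u^i_j\alpha_{i+1}$ for $1\le i\le 19$, $1\le j\le k+2$; and $u^i_ju^i_{j+1}$ for $1\le i\le 19$, $1\le j\le k+1$. Theorem. For every integer $k\ge 0$, the graph $G_k$ is planar, is $B_{k+1}$-CPG, and is not $B_k$-CPG. In particular, for every $k\ge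 0$ there exists a planar graph that is $B_{k+1}$-CPG but not $B_k$-CPG. -/

import Mathlib

namespace CPG

/-! ### Contact representations by paths on a grid -/

/-- The (infinite, rectangular) grid: the points are the integer points of the plane, and two points
are joined by a grid-edge when they are at distance one. -/
def grid : SimpleGraph (ℤ × ℤ) where
  Adj p q := |p.1 - q.1| + |p.2 - q.2| = 1
  symm := ⟨fun p q h => by rw [abs_sub_comm q.1, abs_sub_comm q.2]; exact h⟩
  loopless := ⟨fun p h => by simp at h⟩

/-- A path on the grid: a simple path of the grid graph with two distinct endpoints. -/
structure GridPath where
  /-- one endpoint -/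
  fst : ℤ × ℤ
  /-- the other endpoint -/
  lst : ℤ × ℤ
  /-- the sequence of grid-points visited by the path -/
  walk : grid.Walk fst lst
  isPath : walk.IsPath
  fst_ne_lst : fst ≠ lst

namespace GridPath

/-- The grid-point `p` belongs to the path `P`. -/
def Mem (P : GridPath) (p : ℤ × ℤ) : Prop := p ∈ P.walk.support

/-- The grid-point `p` is an endpoint of the path `P`. -/
def IsEndpoint (P : GridPath) (p : ℤ × ℤ) : Prop := p = P.fst ∨ p = P.lst

/-- The number of bends of a path: the number of visited points, other than the two endpoints, at
which the step leaving the point has a direction different from the step entering it. (The path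
being simple, the two directions are never opposite, so this is a 90-degree turn.) -/
def bends (P : GridPath) : ℕ :=
  ((Finset.range (P.walk.length - 1)).filter fun i =>
    P.walk.getVert (i + 2) - P.walk.getVert (i + 1) ≠
      P.walk.getVert (i + 1) - P.walk.getVert i).card

/-- Two paths are interiorly disjoint (as curves in the plane): they share no grid-edge, and a
grid-point that belongs to both is an endpoint of at least one of them. -/
def InteriorlyDisjoint (P Q : GridPath) : Prop :=
  (∀ e, e ∈ P.walk.edges → e ∉ Q.walk.edges) ∧
    ∀ p, P.Mem p → Q.Mem p → P.IsEndpoint p ∨ Q.IsEndpoint p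

/-- Two paths touch when they have a common point. -/
def Touch (P Q : GridPath) : Prop := ∃ p, P.Mem p ∧ Q.Mem p

end GridPath

/-- A CPG representation of `G`: pairwise interiorly disjoint paths on the grid, one for each
vertex, such that two vertices are adjacent if and only if their paths touch. -/
structure Representation {V : Type*} (G : SimpleGraph V) where
  /-- the path representing a vertex -/
  path : V → GridPath
  disjoint : ∀ u v, u ≠ v → (path u).InteriorlyDisjoint (path v)
  adj_iff : ∀ u v, u ≠ v → (G.Adj u v ↔ (path u).Touch (path v))

/-- `G` is `B_k`-CPG: it has a CPG representation in which every path has at most `k` bends. -/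
def IsBendCPG (k : ℕ) {V : Type*} (G : SimpleGraph V) : Prop :=
  ∃ R : Representation G, ∀ v, (R.path v).bends ≤ k

/-! ### Planar graphs -/

/-- A drawing of `G` in the plane without crossings: the vertices are distinct points, every edge
`uv` is drawn as a simple arc from `u` to `v`, an arc contains no vertex other than its two ends, and
two distinct arcs meet only at common ends of the two edges. -/
structure PlaneDrawing {V : Type*} (G : SimpleGraph V) where
  /-- the point representing a vertex -/
  pos : V → ℝ × ℝ
  /-- the arc representing an edge, as a set of points (irrelevant for non-edges) -/
  arc : Sym2 V → Set (ℝ × ℝ)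
  pos_injective : Function.Injective pos
  isArc : ∀ u v, G.Adj u v →
    ∃ γ : Path (pos u) (pos v), Function.Injective γ ∧ Set.range γ = arc s(u, v)
  mem_of_pos_mem_arc : ∀ e ∈ G.edgeSet, ∀ w, pos w ∈ arc e → w ∈ e
  arc_inter : ∀ e ∈ G.edgeSet, ∀ f ∈ G.edgeSet, e ≠ f →
    ∀ x, x ∈ arc e → x ∈ arc f → ∃ w, w ∈ e ∧ w ∈ f ∧ pos w = x

/-- A graph is planar when it has a drawing in the plane without crossings. -/
def IsPlanar {V : Type*} (G : SimpleGraph V) : Prop := Nonempty (PlaneDrawing G)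

/-! ### The graphs `G_k` -/

/-- The vertices of `G_k`: the two vertices `a` and `b`, twenty secondary vertices, and nineteen
groups of `k + 2` sewing vertices. (Indices start at `0`.) -/
inductive Vertex (k : ℕ) : Type
  | a : Vertex k
  | b : Vertex k
  | secondary (i : Fin 20) : Vertex k
  | sewing (i : Fin 19) (j : Fin (k + 2)) : Vertex k

/-- The edges of `G_k`, each listed in one orientation. -/
inductive Edge (k : ℕ) : Vertex k → Vertex k → Prop
  | ab : Edge k .a .b
  | a_secondary (i : Fin 20) : Edge k .a (.secondary i)
  | b_secondary (i : Fin 20) : Edge k .b (.secondary i)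
  | sewing_left (i : Fin 19) (j : Fin (k + 2)) : Edge k (.sewing i j) (.secondary i.castSucc)
  | sewing_right (i : Fin 19) (j : Fin (k + 2)) : Edge k (.sewing i j) (.secondary i.succ)
  | sewing_path (i : Fin 19) (j : Fin (k + 1)) :
      Edge k (.sewing i j.castSucc) (.sewing i j.succ)

/-- The graph `G_k`: `a` and `b` are adjacent, both are joined to all secondary vertices, and the
sewing vertices of the `i`-th group form a path, in their order, and are all joined to the `i`-th and
the `(i+1)`-st secondary vertex. -/
def sewnGraph (k : ℕ) : SimpleGraph (Vertex k) := SimpleGraph.fromRel (Edge k)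

end CPG

/-! ### Adjacency in `sewnGraph` -/

namespace CPG

/-! Lower bound. The paths of `a` and `b` have four endpoints in all, and each lies on at most one
secondary path, so some four consecutive secondary paths avoid them all (`exists_four_good`). Such a
good path has one end on the path of `a`, the other on the path of `b`, and meets these two paths
nowhere else. A sewing path between two good neighbours α and α' has one end on each. Hence two
consecutive sewing paths meet at a point of α or of α', and both of them end there.

The geometric core is that such a meeting point is a bend (`GridPath.mem_bendPoints_of_meet`). Close
α into a closed walk through the paths of `a` and `b`. If α were straight at the meeting point, the
two sewing paths would leave it on opposite sides of this closed walk; yet they are joined by the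
interior of α', which avoids the walk. Sides are told apart by a parity colouring, a discrete form
of the Jordan curve theorem that does not need the closed walk to be simple.

A group of sewing paths thus yields `k + 1` distinct bends, which alternate between α and α', so
each of the two receives at most half of them, rounded up (`exists_bendPoints`). Different groups
use different bends. Across the three gaps between four good paths, the two middle paths receive at
least `(k + 1) + k / 2 + k / 2` bends, more than the `2 * k` available (`not_isBendCPG`).

Upper bound. The secondary paths are diagonal translates of one staircase with `k + 1` bends, and
the sewing paths are unit segments between neighbouring staircases (`isBendCPG_succ`).

Planarity. An explicit straight-line drawing is checked one pair of edge types at a time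
(`segmentsMeetAtEnds`). -/

theorem edge_iff {k : ℕ} (u v : Vertex k) : Edge k u v ↔
    match u, v with
    | .a, .b => True
    | .a, .secondary _ => True
    | .b, .secondary _ => True
    | .sewing i _, .secondary l => l = i.castSucc ∨ l = i.succ
    | .sewing i j, .sewing i' j' => i' = i ∧ j'.val = j.val + 1
    | _, _ => False := by
  constructor
  · rintro ⟨⟩ <;> simp
  · rcases u with _ | _ | i | ⟨i, j⟩ <;> rcases v with _ | _ | i' | ⟨i', j'⟩ <;> simp
    · exact .ab
    · exact .a_secondary _
    · exact .b_secondary _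
    · rintro (rfl | rfl)
      · exact .sewing_left _ _
      · exact .sewing_right _ _
    · rintro rfl h
      obtain ⟨j, hj⟩ := j
      obtain ⟨j', hj'⟩ := j'
      obtain rfl : j' = j + 1 := h
      exact .sewing_path i' ⟨j, by omega⟩

theorem adj_iff_edge {k : ℕ} (u v : Vertex k) :
    (sewnGraph k).Adj u v ↔ Edge k u v ∨ Edge k v u := by
  rw [sewnGraph, SimpleGraph.fromRel_adj]
  refine ⟨fun h => h.2, fun h => ⟨?_, h⟩⟩
  rintro rfl
  rcases u with _ | _ | i | ⟨i, j⟩ <;> simp [edge_iff] at h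

/-! ### A discrete Jordan curve theorem -/

/-- Whether a grid-edge crosses the upward ray issuing from the unit square with lower left
corner `f`. -/
def rayHit (f p q : ℤ × ℤ) : ZMod 2 :=
  if p.2 = q.2 ∧ f.2 < p.2 ∧ ((p.1 = f.1 ∧ q.1 = f.1 + 1) ∨ (q.1 = f.1 ∧ p.1 = f.1 + 1))
  then 1 else 0

/-- The number of times, modulo `2`, that a walk crosses the upward ray issuing from the unit square
with lower left corner `f`. -/
def color (f : ℤ × ℤ) : {u v : ℤ × ℤ} → grid.Walk u v → ZMod 2
  | _, _, .nil => 0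
  | _, _, .cons (u := u) (v := v) _ w => rayHit f u v + color f w

/-- The rays of two vertically adjacent squares differ only in crossing their common side. -/
theorem color_sub_one_snd (x y : ℤ) {u v : ℤ × ℤ} (w : grid.Walk u v) :
    color (x, y - 1) w = color (x, y) w + (w.edges.count s((x, y), (x + 1, y)) : ZMod 2) := by
  induction w with
  | nil => simp [color]
  | @cons u v z h w ih =>
    have key : rayHit (x, y - 1) u v =
        rayHit (x, y) u v + (if s(u, v) = s((x, y), (x + 1, y)) then 1 else 0) := by
      obtain ⟨u1, u2⟩ := u
      obtain ⟨v1, v2⟩ := v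
      simp only [rayHit, Sym2.eq_iff, Prod.mk.injEq]
      split_ifs <;> first | rfl | (exfalso; omega)
    simp only [color, ih, key, SimpleGraph.Walk.edges_cons, List.count_cons, beq_iff_eq]
    push_cast
    ring

/-- The left side counts, modulo `2`, the steps entering or leaving the vertical half-line of
abscissa `x` above height `y`: sideways through one of the two columns, or through its bottom edge.
Only the positions of the two ends of the walk matter for this parity, so it vanishes for a closed
walk. -/
theorem color_add_color_sub_one_fst (x y : ℤ) {u v : ℤ × ℤ} (w : grid.Walk u v) :
    color (x, y) w + color (x - 1, y) w + (w.edges.count s((x, y), (x, y + 1)) : ZMod 2) =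
      (if u.1 = x ∧ y < u.2 then 1 else 0) + (if v.1 = x ∧ y < v.2 then 1 else 0) := by
  induction w with
  | nil => simp [color, CharTwo.add_self_eq_zero]
  | @cons u v z h w ih =>
    have key : rayHit (x, y) u v + rayHit (x - 1, y) u v +
        (if s(u, v) = s((x, y), (x, y + 1)) then 1 else 0) =
        (if u.1 = x ∧ y < u.2 then 1 else 0) + (if v.1 = x ∧ y < v.2 then 1 else 0) := by
      obtain ⟨u1, u2⟩ := u
      obtain ⟨v1, v2⟩ := v
      have h' : |u1 - v1| + |u2 - v2| = 1 := h
      simp only [rayHit, Sym2.eq_iff, Prod.mk.injEq]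
      have : (u1 = v1 ∧ (u2 = v2 + 1 ∨ v2 = u2 + 1)) ∨
        (u2 = v2 ∧ (u1 = v1 + 1 ∨ v1 = u1 + 1)) := by
        rcases abs_cases (u1 - v1) with h1 | h1 <;> rcases abs_cases (u2 - v2) with h2 | h2 <;> omega
      clear h h' ih
      rcases this with ⟨rfl, rfl | rfl⟩ | ⟨rfl, rfl | rfl⟩ <;>
      split_ifs <;> first | rfl | (exfalso; omega)
    have two (t : ZMod 2) : t + t = 0 := CharTwo.add_self_eq_zero t
    simp only [color, SimpleGraph.Walk.edges_cons, List.count_cons, beq_iff_eq]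
    push_cast
    linear_combination key + ih + two (if v.1 = x ∧ y < v.2 then 1 else 0)

theorem color_sub_one_fst (x y : ℤ) {u : ℤ × ℤ} (w : grid.Walk u u) :
    color (x - 1, y) w = color (x, y) w + (w.edges.count s((x, y), (x, y + 1)) : ZMod 2) := by
  have h := color_add_color_sub_one_fst x y w
  rw [CharTwo.add_self_eq_zero] at h
  have two (t : ZMod 2) : t + t = 0 := CharTwo.add_self_eq_zero t
  linear_combination h - two (color (x, y) w) - two (w.edges.count s((x, y), (x, y + 1)) : ZMod 2)

theorem count_edges_eq_zero {u v p q : ℤ × ℤ} (w : grid.Walk u v)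
    (h : p ∉ w.support ∨ q ∉ w.support) : w.edges.count s(p, q) = 0 := by
  rw [List.count_eq_zero]
  rcases h with h | h
  · exact fun hm => h (w.fst_mem_support_of_mem_edges hm)
  · exact fun hm => h (w.snd_mem_support_of_mem_edges hm)

theorem grid_adj_cases {p q : ℤ × ℤ} (h : grid.Adj p q) :
    q = (p.1 + 1, p.2) ∨ q = (p.1 - 1, p.2) ∨ q = (p.1, p.2 + 1) ∨ q = (p.1, p.2 - 1) := by
  obtain ⟨u1, u2⟩ := p
  obtain ⟨v1, v2⟩ := q
  have h' : |u1 - v1| + |u2 - v2| = 1 := h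
  simp only [Prod.mk.injEq]
  rcases abs_cases (u1 - v1) with h1 | h1 <;> rcases abs_cases (u2 - v2) with h2 | h2 <;> omega

/-- A grid-point is coloured as the square of which it is the lower left corner. The common side of
the squares of two adjacent points contains one of these points, so the walk does not use it. -/
theorem color_eq_of_adj {u p q : ℤ × ℤ} (w : grid.Walk u u) (h : grid.Adj p q)
    (hp : p ∉ w.support) (hq : q ∉ w.support) : color p w = color q w := by
  obtain ⟨x, y⟩ := p
  rcases grid_adj_cases h with rfl | rfl | rfl | rfl
  · have := color_sub_one_fst (x + 1) y w
    rw [count_edges_eq_zero w (.inl hq)] at this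
    simpa using this
  · have := color_sub_one_fst x y w
    rw [count_edges_eq_zero w (.inl hp)] at this
    simpa using this.symm
  · have := color_sub_one_snd x (y + 1) w
    rw [count_edges_eq_zero w (.inl hq)] at this
    simpa using this
  · have := color_sub_one_snd x y w
    rw [count_edges_eq_zero w (.inl hp)] at this
    simpa using this.symm

/-- The colour changes when a closed walk is crossed at a vertex it traverses in a straight line. -/
theorem color_ne_of_opposite {u p q r s : ℤ × ℤ} (w : grid.Walk u u)
    (hq : grid.Adj p q) (hr : grid.Adj p r) (hs : grid.Adj p s) (hqr : q ≠ r) (hqs : q ≠ s)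
    (hrs : r ≠ s) (hqr' : p - q ≠ r - p) (hqs' : p - q ≠ s - p)
    (h1 : w.edges.count s(p, q) = 1) (h2 : w.edges.count s(p, p - (q - p)) = 1)
    (hrw : r ∉ w.support) (hsw : s ∉ w.support) : color r w ≠ color s w := by
  have flip : ∀ t t' : ZMod 2, t = t' + 1 → t ≠ t' := by decide
  obtain ⟨x, y⟩ := p
  -- Passing from the square below to the square above `(x, y)` crosses two sides: one is the edge
  -- to the right of `(x, y)`, traversed once, and the other contains a point off the walk. When `q`
  -- lies to the left or below, the edge needed is the opposite one, supplied by `h2`.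
  have hor : ∀ q' : ℤ × ℤ, q' = (x + 1, y) → w.edges.count s((x, y), q') = 1 →
      (x, y + 1) ∉ w.support → (x, y - 1) ∉ w.support →
      color (x, y - 1) w ≠ color (x, y + 1) w := by
    rintro _ rfl hc ha hb
    have e1 := color_sub_one_snd x y w
    have e2 := color_sub_one_snd x (y + 1) w
    rw [count_edges_eq_zero w (.inl ha)] at e2
    rw [hc] at e1
    apply flip
    simp only [add_sub_cancel_right, Nat.cast_zero, Nat.cast_one, add_zero] at e1 e2
    rw [e1, e2]
  have ver : ∀ q' : ℤ × ℤ, q' = (x, y + 1) → w.edges.count s((x, y), q') = 1 →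
      (x + 1, y) ∉ w.support → (x - 1, y) ∉ w.support →
      color (x - 1, y) w ≠ color (x + 1, y) w := by
    rintro _ rfl hc ha hb
    have e1 := color_sub_one_fst x y w
    have e2 := color_sub_one_fst (x + 1) y w
    rw [count_edges_eq_zero w (.inl ha)] at e2
    rw [hc] at e1
    apply flip
    simp only [add_sub_cancel_right, Nat.cast_zero, Nat.cast_one, add_zero] at e1 e2
    rw [e1, e2]
  rcases grid_adj_cases hq with rfl | rfl | rfl | rfl <;>
  rcases grid_adj_cases hr with rfl | rfl | rfl | rfl <;>
  rcases grid_adj_cases hs with rfl | rfl | rfl | rfl <;>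
  simp at hqr hqs hrs hqr' hqs' <;>
  first
  | exact hor _ rfl h1 ‹_› ‹_›
  | exact (hor _ rfl h1 ‹_› ‹_›).symm
  | exact ver _ rfl h1 ‹_› ‹_›
  | exact (ver _ rfl h1 ‹_› ‹_›).symm
  | exact hor _ (by simp) h2 ‹_› ‹_›
  | exact (hor _ (by simp) h2 ‹_› ‹_›).symm
  | exact ver _ (by simp) h2 ‹_› ‹_›
  | exact (ver _ (by simp) h2 ‹_› ‹_›).symm

end CPG

/-! ### Two sewing paths meeting on a secondary path force a bend -/

namespace CPG

theorem apply_eq_of_mem_support {α : Type*} {u v : ℤ × ℤ} (w : grid.Walk u v) (c : ℤ × ℤ → α)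
    (h : ∀ r ∈ w.support, ∀ s ∈ w.support, grid.Adj r s → c r = c s) :
    ∀ r ∈ w.support, c r = c u := by
  induction w with
  | nil => simp
  | @cons u v z huv w ih =>
    intro r hr
    rw [SimpleGraph.Walk.support_cons, List.mem_cons] at hr
    rcases hr with rfl | hr
    · rfl
    · rw [ih (fun r hr s hs => h r (by simp [hr]) s (by simp [hs])) r hr]
      exact h _ (by simp) _ (by simp) huv.symm

theorem exists_tail {p q : ℤ × ℤ} (w : grid.Walk p q) (hw : w.IsPath) (hpq : p ≠ q) :
    ∃ n, grid.Adj p n ∧ s(p, n) ∈ w.edges ∧ ∃ t : grid.Walk n q, t.IsPath ∧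
      ∀ r, r ∈ t.support ↔ r ∈ w.support ∧ r ≠ p := by
  cases w with
  | nil => exact absurd rfl hpq
  | @cons _ n _ h t =>
    rw [SimpleGraph.Walk.cons_isPath_iff] at hw
    refine ⟨n, h, by simp, t, hw.1, fun r => ?_⟩
    rw [SimpleGraph.Walk.support_cons, List.mem_cons]
    constructor
    · exact fun hr => ⟨.inr hr, fun hrp => hw.2 (hrp ▸ hr)⟩
    · rintro ⟨rfl | hr, hne⟩
      · exact absurd rfl hne
      · exact hr

/-- A path deprived of both its ends is still connected. This is applied to a good secondary path,
whose ends may lie on the closed walk while its interior does not. -/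
theorem apply_eq_of_interior {α : Type*} {p q : ℤ × ℤ} (w : grid.Walk p q) (hw : w.IsPath)
    (hpq : p ≠ q) (c : ℤ × ℤ → α)
    (h : ∀ r ∈ w.support, ∀ s ∈ w.support, r ≠ p → r ≠ q → s ≠ p → s ≠ q →
      grid.Adj r s → c r = c s) :
    ∀ r ∈ w.support, ∀ s ∈ w.support, r ≠ p → r ≠ q → s ≠ p → s ≠ q → c r = c s := by
  obtain ⟨n, -, -, t, ht, htw⟩ := exists_tail w hw hpq
  intro r hr s hs hrp hrq hsp hsq
  by_cases hnq : n = q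
  · subst hnq
    have := SimpleGraph.Walk.isPath_iff_nil.mp ht
    have hr' := (htw r).2 ⟨hr, hrp⟩
    rw [SimpleGraph.Walk.nil_iff_support_eq.mp this] at hr'
    exact absurd (by simpa using hr') hrq
  obtain ⟨m, -, -, t', ht', htw'⟩ := exists_tail t.reverse ht.reverse (Ne.symm hnq)
  have mem : ∀ r, r ∈ t'.support ↔ r ∈ w.support ∧ r ≠ p ∧ r ≠ q := by
    intro r
    rw [htw', SimpleGraph.Walk.support_reverse, List.mem_reverse, htw]
    tauto
  have := apply_eq_of_mem_support t' c fun r hr s hs =>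
    h r ((mem r).1 hr).1 s ((mem s).1 hs).1 ((mem r).1 hr).2.1 ((mem r).1 hr).2.2
      ((mem s).1 hs).2.1 ((mem s).1 hs).2.2
  rw [this r ((mem r).2 ⟨hr, hrp, hrq⟩), this s ((mem s).2 ⟨hs, hsp, hsq⟩)]

namespace GridPath

/-- The points at which a path bends. -/
def bendPoints (P : GridPath) : Finset (ℤ × ℤ) :=
  ((Finset.range (P.walk.length - 1)).filter fun i =>
    P.walk.getVert (i + 2) - P.walk.getVert (i + 1) ≠
      P.walk.getVert (i + 1) - P.walk.getVert i).image fun i => P.walk.getVert (i + 1)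

theorem card_bendPoints_le (P : GridPath) : P.bendPoints.card ≤ P.bends := Finset.card_image_le

theorem Touch.symm {P Q : GridPath} (h : P.Touch Q) : Q.Touch P :=
  let ⟨p, h1, h2⟩ := h; ⟨p, h2, h1⟩

theorem exists_walk_of_mem (P : GridPath) {p q : ℤ × ℤ} (hp : P.Mem p) (hq : P.Mem q) :
    ∃ w : grid.Walk p q, ∀ r ∈ w.support, P.Mem r := by
  refine ⟨(P.walk.takeUntil p hp).reverse.append (P.walk.takeUntil q hq), fun r hr => ?_⟩
  rw [SimpleGraph.Walk.mem_support_append_iff, SimpleGraph.Walk.support_reverse,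
    List.mem_reverse] at hr
  rcases hr with hr | hr
  · exact P.walk.support_takeUntil_subset_support _ hr
  · exact P.walk.support_takeUntil_subset_support _ hr

theorem exists_walk_of_touch {P Q : GridPath} (h : P.Touch Q) {p q : ℤ × ℤ}
    (hp : P.Mem p ∨ Q.Mem p) (hq : P.Mem q ∨ Q.Mem q) :
    ∃ w : grid.Walk p q, ∀ r ∈ w.support, P.Mem r ∨ Q.Mem r := by
  obtain ⟨z, hz1, hz2⟩ := h
  have : ∀ p, (P.Mem p ∨ Q.Mem p) → ∃ w : grid.Walk p z, ∀ r ∈ w.support, P.Mem r ∨ Q.Mem r := by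
    rintro p (hp | hp)
    · exact (P.exists_walk_of_mem hp hz1).imp fun w hw r hr => .inl (hw r hr)
    · exact (Q.exists_walk_of_mem hp hz2).imp fun w hw r hr => .inr (hw r hr)
  obtain ⟨w1, h1⟩ := this p hp
  obtain ⟨w2, h2⟩ := this q hq
  refine ⟨w1.append w2.reverse, fun r hr => ?_⟩
  rw [SimpleGraph.Walk.mem_support_append_iff, SimpleGraph.Walk.support_reverse,
    List.mem_reverse] at hr
  exact hr.elim (h1 r) (h2 r)

/-- A path seen from one of its endpoints. -/
theorem IsEndpoint.exists_walk {P : GridPath} {p : ℤ × ℤ} (h : P.IsEndpoint p) :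
    ∃ (q : ℤ × ℤ) (w : grid.Walk p q), w.IsPath ∧ p ≠ q ∧ P.IsEndpoint q ∧
      (∀ r, P.IsEndpoint r → r = p ∨ r = q) ∧
      (∀ r, r ∈ w.support ↔ P.Mem r) ∧ ∀ e, e ∈ w.edges ↔ e ∈ P.walk.edges := by
  rcases h with rfl | rfl
  · exact ⟨_, P.walk, P.isPath, P.fst_ne_lst, .inr rfl, fun r hr => hr, fun _ => Iff.rfl,
      fun _ => Iff.rfl⟩
  · exact ⟨_, P.walk.reverse, P.isPath.reverse, P.fst_ne_lst.symm, .inl rfl,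
      fun r hr => hr.symm, fun r => by simp [Mem], fun e => by simp⟩

theorem exists_getVert_of_interior {P : GridPath} {p : ℤ × ℤ} (h : P.Mem p)
    (hp : ¬ P.IsEndpoint p) : ∃ i, i < P.walk.length - 1 ∧ P.walk.getVert (i + 1) = p := by
  obtain ⟨n, hn, hle⟩ := SimpleGraph.Walk.mem_support_iff_exists_getVert.mp h
  have h0 : n ≠ 0 := by
    rintro rfl
    exact hp (.inl (by rw [← hn, SimpleGraph.Walk.getVert_zero]))
  have h1 : n ≠ P.walk.length := by
    rintro rfl
    exact hp (.inr (by rw [← hn, SimpleGraph.Walk.getVert_length]))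
  exact ⟨n - 1, by omega, by rw [← hn]; congr 1; omega⟩

/-- A path `u` joining `α` to `α'` meets `α` only at its end `p`; every function that is constant
along `u` off `α` takes the same value at the neighbour `n` of `p` and at the other end `z`. -/
theorem exists_exit {α α' u : GridPath} {p : ℤ × ℤ}
    (hα : ∀ r, u.Mem r → α.Mem r → u.IsEndpoint r)
    (hα' : ∀ r, u.Mem r → α'.Mem r → u.IsEndpoint r)
    (hαα' : ¬ α.Touch α') (huα' : u.Touch α') (hup : u.Mem p) (hp : α.Mem p) :
    ∃ n z, grid.Adj p n ∧ s(p, n) ∈ u.walk.edges ∧ u.Mem z ∧ α'.Mem z ∧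
      (∀ r, u.Mem r → α.Mem r → r = p) ∧ (u.Mem n ∧ ¬ α.Mem n) ∧
      ∀ c : ℤ × ℤ → ZMod 2, (∀ r s, u.Mem r → u.Mem s → ¬ α.Mem r → ¬ α.Mem s → grid.Adj r s →
        c r = c s) → c n = c z := by
  obtain ⟨q, w, hw, hpq, hq, hends, hsup, hedge⟩ := (hα p hup hp).exists_walk
  obtain ⟨z, hzu, hz⟩ := huα'
  have hzq : z = q := by
    rcases hends z (hα' z hzu hz) with h | h
    · exact absurd ⟨p, hp, h ▸ hz⟩ hαα'
    · exact h
  subst hzq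
  obtain ⟨n, hpn, hne, t, ht, htw⟩ := exists_tail w hw hpq
  have only : ∀ r, u.Mem r → α.Mem r → r = p := by
    intro r hr hr'
    rcases hends r (hα r hr hr') with h | h
    · exact h
    · exact absurd ⟨z, h ▸ hr', hz⟩ hαα'
  have off : ∀ r ∈ t.support, u.Mem r ∧ ¬ α.Mem r := fun r hr =>
    ⟨(hsup r).1 ((htw r).1 hr).1, fun h => ((htw r).1 hr).2 (only r ((hsup r).1 ((htw r).1 hr).1) h)⟩
  refine ⟨n, z, hpn, (hedge _).1 hne, hzu, hz, only, off n t.start_mem_support, fun c hc => ?_⟩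
  exact (apply_eq_of_mem_support t c (fun r hr s hs => hc r s (off r hr).1 (off s hs).1
    (off r hr).2 (off s hs).2) z t.end_mem_support).symm

/-- Two paths `u` and `u'` ending at the same point of `α`, both joining `α` to `α'`, end at a bend
of `α`. -/
theorem mem_bendPoints_of_meet {A B α α' u u' : GridPath} {p : ℤ × ℤ} (hAB : A.Touch B)
    (hαe : ∀ r, α.IsEndpoint r → A.Mem r ∨ B.Mem r)
    (hα'e : ∀ r, α'.Mem r → A.Mem r ∨ B.Mem r → α'.IsEndpoint r)
    (hα'e' : ∀ r, α'.IsEndpoint r → A.Mem r ∨ B.Mem r)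
    (hαα' : ¬ α.Touch α')
    (hu : ∀ r, u.Mem r → ¬ (A.Mem r ∨ B.Mem r)) (hu' : ∀ r, u'.Mem r → ¬ (A.Mem r ∨ B.Mem r))
    (huα : α.InteriorlyDisjoint u) (huα' : α'.InteriorlyDisjoint u)
    (hu'α : α.InteriorlyDisjoint u') (hu'α' : α'.InteriorlyDisjoint u')
    (huu' : u.InteriorlyDisjoint u')
    (ht : u.Touch α') (ht' : u'.Touch α')
    (hp : α.Mem p) (hpu : u.Mem p) (hpu' : u'.Mem p) : p ∈ α.bendPoints := by
  have hpAB := hu p hpu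
  obtain ⟨n, z, hpn, hne, hzu, hz, only, hn, conn⟩ := exists_exit (α := α) (α' := α') (u := u)
    (fun r hr hr' => (huα.2 r hr' hr).resolve_left fun h => hu r hr (hαe r h))
    (fun r hr hr' => (huα'.2 r hr' hr).resolve_left fun h => hu r hr (hα'e' r h)) hαα' ht hpu hp
  obtain ⟨n', z', hpn', hne', hzu', hz', only', hn', conn'⟩ :=
    exists_exit (α := α) (α' := α') (u := u')
    (fun r hr hr' => (hu'α.2 r hr' hr).resolve_left fun h => hu' r hr (hαe r h))
    (fun r hr hr' => (hu'α'.2 r hr' hr).resolve_left fun h => hu' r hr (hα'e' r h)) hαα' ht' hpu' hp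
  obtain ⟨i, hi, hip⟩ := exists_getVert_of_interior hp fun h => hpAB (hαe p h)
  rw [bendPoints, Finset.mem_image]
  refine ⟨i, ?_, hip⟩
  rw [Finset.mem_filter, Finset.mem_range]
  refine ⟨hi, fun hstraight => ?_⟩
  -- The walk `β` closes `α` inside `A ∪ B`. It may repeat points or run along `α`, but it avoids
  -- `p`, so the two edges of `α` at `p` are each traversed exactly once.
  obtain ⟨β, hβ⟩ := exists_walk_of_touch hAB (hαe α.lst (.inr rfl)) (hαe α.fst (.inl rfl))
  have hpβ : p ∉ β.support := fun h => hpAB (hβ p h)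
  have hadj1 := α.walk.adj_getVert_succ (i := i) (by omega)
  have hadj2 := α.walk.adj_getVert_succ (i := i + 1) (by omega)
  have he1 : s(p, α.walk.getVert i) ∈ α.walk.edges := by
    rw [← hip, Sym2.eq_swap]
    rw [SimpleGraph.Walk.mk_mem_edges_iff_exists]
    exact ⟨i, by omega, rfl⟩
  have he2 : s(p, α.walk.getVert (i + 2)) ∈ α.walk.edges := by
    rw [← hip]
    rw [SimpleGraph.Walk.mk_mem_edges_iff_exists]
    exact ⟨i + 1, by omega, rfl⟩
  rw [hip] at hadj1 hadj2 hstraight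
  have hprev : α.walk.getVert i = p - (α.walk.getVert (i + 2) - p) := by
    rw [hstraight]; abel
  have count : ∀ q, s(p, q) ∈ α.walk.edges → (α.walk.append β).edges.count s(p, q) = 1 := by
    intro q hq
    rw [SimpleGraph.Walk.edges_append, List.count_append, count_edges_eq_zero β (.inl hpβ),
      List.count_eq_one_of_mem α.isPath.isTrail.edges_nodup hq]
  have off : ∀ r, ¬ α.Mem r → ¬ (A.Mem r ∨ B.Mem r) → r ∉ (α.walk.append β).support := by
    intro r h1 h2 h
    rw [SimpleGraph.Walk.mem_support_append_iff] at h
    exact h.elim h1 fun h => h2 (hβ r h)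
  have disj : ∀ {q r}, s(p, q) ∈ α.walk.edges → ∀ v : GridPath, α.InteriorlyDisjoint v →
      s(p, r) ∈ v.walk.edges → q ≠ r := by
    rintro q r hq v hv hr rfl
    exact hv.1 _ hq hr
  have hnn' : n ≠ n' := by
    rintro rfl
    exact huu'.1 _ hne hne'
  refine color_ne_of_opposite (α.walk.append β) hadj2 hpn hpn' (disj he2 u huα hne)
    (disj he2 u' hu'α hne') hnn' ?_ ?_ (count _ he2) ?_ (off n hn.2 (hu n hn.1))
    (off n' hn'.2 (hu' n' hn'.1)) ?_
  · intro h
    refine disj he1 u huα hne ?_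
    rw [hprev, eq_add_of_sub_eq h.symm]; abel
  · intro h
    refine disj he1 u' hu'α hne' ?_
    rw [hprev, eq_add_of_sub_eq h.symm]; abel
  · rw [← hprev]; exact count _ he1
  -- The colour is carried from `n` along `u` to `z`, along the interior of `α'` to `z'`, and back
  -- along `u'` to `n'`. The points `z` and `z'` are interior to `α'` because the ends of `α'` lie
  -- on `A ∪ B`, which `u` and `u'` avoid.
  · rw [conn _ fun r s hr hs hr' hs' h => color_eq_of_adj _ h (off r hr' (hu r hr))
      (off s hs' (hu s hs)),
      conn' _ fun r s hr hs hr' hs' h => color_eq_of_adj _ h (off r hr' (hu' r hr))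
      (off s hs' (hu' s hs))]
    have inner : ∀ r, α'.Mem r → r ≠ α'.fst → r ≠ α'.lst → r ∉ (α.walk.append β).support := by
      intro r hr h1 h2
      refine off r (fun h => hαα' ⟨r, h, hr⟩) fun h => ?_
      exact (hα'e r hr h).elim h1 h2
    have ne : ∀ r v, v = u ∨ v = u' → v.Mem r → r ≠ α'.fst ∧ r ≠ α'.lst := by
      rintro r v (rfl | rfl) hr
      · exact ⟨fun h => hu r hr (hα'e' r (.inl h)), fun h => hu r hr (hα'e' r (.inr h))⟩
      · exact ⟨fun h => hu' r hr (hα'e' r (.inl h)), fun h => hu' r hr (hα'e' r (.inr h))⟩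
    exact apply_eq_of_interior α'.walk α'.isPath α'.fst_ne_lst _
      (fun r hr s hs h1 h2 h3 h4 h => color_eq_of_adj _ h (inner r hr h1 h2) (inner s hs h3 h4))
      z hz z' hz' (ne z u (.inl rfl) hzu).1 (ne z u (.inl rfl) hzu).2
      (ne z' u' (.inr rfl) hzu').1 (ne z' u' (.inr rfl) hzu').2

end GridPath
end CPG

/-! ### Lower bound: counting forced bends -/

namespace CPG
open GridPath

/-- Of any two consecutive indices exactly one satisfies `p`; an odd `n` leaves one index over. -/
theorem two_mul_count_le (p : ℕ → Prop) [DecidablePred p] :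
    ∀ n, (∀ j, j + 1 < n → (p (j + 1) ↔ ¬ p j)) → 2 * Nat.count p n ≤ n + 1
  | 0, _ => by simp
  | 1, _ => by
    rw [Nat.count_succ, Nat.count_zero]
    split_ifs <;> omega
  | n + 2, h => by
    have ih := two_mul_count_le p n fun j hj => h j (by omega)
    have := h n (by omega)
    rw [Nat.count_succ, Nat.count_succ]
    by_cases hn : p n
    · rw [if_pos hn, if_neg (by tauto)]; omega
    · rw [if_neg hn, if_pos (by tauto)]; omega

section lowerBound

variable {k : ℕ} (R : Representation (sewnGraph k))

/-- The path of a secondary vertex contains no endpoint of the paths of `a` and `b`. -/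
def IsGood (l : Fin 20) : Prop :=
  ∀ r, ((R.path .a).IsEndpoint r ∨ (R.path .b).IsEndpoint r) → ¬ (R.path (.secondary l)).Mem r

variable {R}

theorem touch_a_secondary (l : Fin 20) : (R.path .a).Touch (R.path (.secondary l)) :=
  (R.adj_iff _ _ (by simp)).1 ((adj_iff_edge _ _).2 (.inl (.a_secondary l)))

theorem touch_b_secondary (l : Fin 20) : (R.path .b).Touch (R.path (.secondary l)) :=
  (R.adj_iff _ _ (by simp)).1 ((adj_iff_edge _ _).2 (.inl (.b_secondary l)))

theorem touch_a_b : (R.path .a).Touch (R.path .b) :=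
  (R.adj_iff _ _ (by simp)).1 ((adj_iff_edge _ _).2 (.inl .ab))

theorem not_touch_secondary {l l' : Fin 20} (h : l ≠ l') :
    ¬ (R.path (.secondary l)).Touch (R.path (.secondary l')) := by
  rw [← R.adj_iff _ _ (by simpa using h), adj_iff_edge]
  simp [edge_iff]

theorem not_mem_of_sewing {i : Fin 19} {j : Fin (k + 2)} (r : ℤ × ℤ)
    (hr : (R.path (.sewing i j)).Mem r) : ¬ ((R.path .a).Mem r ∨ (R.path .b).Mem r) := by
  rintro (h | h)
  · have := (R.adj_iff (.sewing i j) .a (by simp)).2 ⟨r, hr, h⟩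
    simp [adj_iff_edge, edge_iff] at this
  · have := (R.adj_iff (.sewing i j) .b (by simp)).2 ⟨r, hr, h⟩
    simp [adj_iff_edge, edge_iff] at this

theorem eq_of_touch_sewing {i i' : Fin 19} {j j' : Fin (k + 2)}
    (h : (R.path (.sewing i j)).Touch (R.path (.sewing i' j'))) :
    i = i' ∧ j.val ≤ j'.val + 1 ∧ j'.val ≤ j.val + 1 := by
  by_cases hne : (Vertex.sewing i j : Vertex k) = .sewing i' j'
  · simp only [Vertex.sewing.injEq] at hne
    obtain ⟨rfl, rfl⟩ := hne
    simp
  · rw [← R.adj_iff _ _ hne, adj_iff_edge] at h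
    simp only [edge_iff] at h
    rcases h with ⟨h1, h2⟩ | ⟨h1, h2⟩
    · exact ⟨h1.symm, by omega⟩
    · exact ⟨h1, by omega⟩

/-- A contact with the path of `a` or `b` is an endpoint of one of the two paths involved, and
goodness leaves only the secondary one. The contacts with `a` and with `b` differ, since a common
point of those two paths is an endpoint of one of them; so they are the two ends. -/
theorem IsGood.endpoints {l : Fin 20} (h : IsGood R l) :
    (∀ r, (R.path (.secondary l)).IsEndpoint r → (R.path .a).Mem r ∨ (R.path .b).Mem r) ∧
    ∀ r, (R.path (.secondary l)).Mem r → (R.path .a).Mem r ∨ (R.path .b).Mem r →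
      (R.path (.secondary l)).IsEndpoint r := by
  have hB : ∀ r, (R.path (.secondary l)).Mem r → (R.path .a).Mem r ∨ (R.path .b).Mem r →
      (R.path (.secondary l)).IsEndpoint r := by
    rintro r hr (h' | h')
    · exact ((R.disjoint (.secondary l) .a (by simp)).2 r hr h').resolve_right
        fun hr' => h r (.inl hr') hr
    · exact ((R.disjoint (.secondary l) .b (by simp)).2 r hr h').resolve_right
        fun hr' => h r (.inr hr') hr
  refine ⟨?_, hB⟩
  obtain ⟨x, hxa, hx⟩ := touch_a_secondary (R := R) l
  obtain ⟨y, hyb, hy⟩ := touch_b_secondary (R := R) l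
  have hxy : x ≠ y := by
    rintro rfl
    exact h x ((R.disjoint .a .b (by simp)).2 x hxa hyb) hx
  have hx' := hB x hx (.inl hxa)
  have hy' := hB y hy (.inr hyb)
  intro r hr
  obtain rfl | rfl : r = x ∨ r = y := by
    unfold IsEndpoint at hx' hy' hr
    rcases hx' with h1 | h1 <;> rcases hy' with h2 | h2 <;> rcases hr with h3 | h3 <;>
      simp_all
  · exact .inl hxa
  · exact .inr hyb

/-- Pigeonhole: were each of the five disjoint blocks of four consecutive secondary paths to contain
one of the four endpoints, some endpoint would be shared by two blocks, and two secondary paths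
would touch. -/
theorem exists_four_good : ∃ n : ℕ, ∃ hn : n + 3 < 20, ∀ m, ∀ hm : m < 4,
    IsGood R ⟨n + m, by omega⟩ := by
  by_contra hcon
  push Not at hcon
  have key : ∀ b : Fin 5, ∃ e : Fin 4, ∃ m, ∃ hm : m < 4,
      (R.path (.secondary ⟨4 * b.val + m, by omega⟩)).Mem
        (![(R.path .a).fst, (R.path .a).lst, (R.path .b).fst, (R.path .b).lst] e) := by
    intro b
    obtain ⟨m, hm, hbad⟩ := hcon (4 * b.val) (by omega)
    unfold IsGood at hbad
    push Not at hbad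
    obtain ⟨r, hr, hmem⟩ := hbad
    rcases hr with (rfl | rfl) | (rfl | rfl)
    · exact ⟨0, m, hm, hmem⟩
    · exact ⟨1, m, hm, hmem⟩
    · exact ⟨2, m, hm, hmem⟩
    · exact ⟨3, m, hm, hmem⟩
  choose e m hm hmem using key
  obtain ⟨b, b', hne, he⟩ := Fintype.exists_ne_map_eq_of_card_lt e (by simp)
  refine not_touch_secondary (R := R) (l := ⟨4 * b.val + m b, by have := hm b; omega⟩)
    (l' := ⟨4 * b'.val + m b', by have := hm b'; omega⟩) ?_ ⟨_, hmem b, he ▸ hmem b'⟩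
  have h1 := hm b
  have h2 := hm b'
  rw [Ne, Fin.mk.injEq]
  intro h
  exact hne (Fin.ext (by omega))

theorem touch_sewing_left (i : Fin 19) (j : Fin (k + 2)) :
    (R.path (.sewing i j)).Touch (R.path (.secondary i.castSucc)) :=
  (R.adj_iff _ _ (by simp)).1 ((adj_iff_edge _ _).2 (.inl (.sewing_left i j)))

theorem touch_sewing_right (i : Fin 19) (j : Fin (k + 2)) :
    (R.path (.sewing i j)).Touch (R.path (.secondary i.succ)) :=
  (R.adj_iff _ _ (by simp)).1 ((adj_iff_edge _ _).2 (.inl (.sewing_right i j)))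

theorem IsGood.isEndpoint_sewing {l : Fin 20} (h : IsGood R l) {i : Fin 19} {j : Fin (k + 2)}
    {r : ℤ × ℤ} (hr : (R.path (.sewing i j)).Mem r) (hr' : (R.path (.secondary l)).Mem r) :
    (R.path (.sewing i j)).IsEndpoint r :=
  ((R.disjoint (.sewing i j) (.secondary l) (by simp)).2 r hr hr').resolve_right
    fun he => not_mem_of_sewing r hr (h.endpoints.1 r he)

theorem eq_of_mem_of_mem {l l' : Fin 20} (hl : IsGood R l) (hl' : IsGood R l') (hne : l ≠ l')
    {i : Fin 19} {j : Fin (k + 2)} (ht' : (R.path (.sewing i j)).Touch (R.path (.secondary l')))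
    {p r : ℤ × ℤ} (hp : (R.path (.sewing i j)).Mem p) (hpl : (R.path (.secondary l)).Mem p)
    (hr : (R.path (.sewing i j)).Mem r) (hrl : (R.path (.secondary l)).Mem r) : r = p := by
  obtain ⟨-, -, -, -, -, -, only, -⟩ := exists_exit (α := R.path (.secondary l))
    (fun r hr hr' => hl.isEndpoint_sewing hr hr') (fun r hr hr' => hl'.isEndpoint_sewing hr hr')
    (not_touch_secondary hne) ht' hp hpl
  exact only r hr hrl

theorem mem_bendPoints_of_sewing {l l' : Fin 20} (hl : IsGood R l) (hl' : IsGood R l')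
    (hne : l ≠ l') {i : Fin 19} {j j' : Fin (k + 2)} (hj : j ≠ j')
    (ht : (R.path (.sewing i j)).Touch (R.path (.secondary l')))
    (ht' : (R.path (.sewing i j')).Touch (R.path (.secondary l')))
    {p : ℤ × ℤ} (hp : (R.path (.sewing i j)).Mem p) (hp' : (R.path (.sewing i j')).Mem p)
    (hpl : (R.path (.secondary l)).Mem p) : p ∈ (R.path (.secondary l)).bendPoints :=
  mem_bendPoints_of_meet touch_a_b hl.endpoints.1 hl'.endpoints.2 hl'.endpoints.1
    (not_touch_secondary hne) not_mem_of_sewing not_mem_of_sewing (R.disjoint _ _ (by simp))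
    (R.disjoint _ _ (by simp)) (R.disjoint _ _ (by simp)) (R.disjoint _ _ (by simp))
    (R.disjoint _ _ (by simpa using hj)) ht ht' hpl hp hp'

/-- The bends of two consecutive good paths at which the sewing vertices between them meet. -/
theorem exists_bendPoints (i : Fin 19) (hl : IsGood R i.castSucc) (hr : IsGood R i.succ) :
    ∃ S ⊆ (R.path (.secondary i.castSucc)).bendPoints,
    ∃ T ⊆ (R.path (.secondary i.succ)).bendPoints,
      (∀ p ∈ S, ∃ j, (R.path (.sewing i j)).Mem p) ∧ (∀ p ∈ T, ∃ j, (R.path (.sewing i j)).Mem p) ∧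
      S.card + T.card = k + 1 ∧ 2 * S.card ≤ k + 2 ∧ 2 * T.card ≤ k + 2 := by
  classical
  have hne : i.castSucc ≠ i.succ := i.castSucc_lt_succ.ne
  have meet : ∀ j : ℕ, ∀ h : j < k + 1, ∃ p, (R.path (.sewing i ⟨j, by omega⟩)).Mem p ∧
      (R.path (.sewing i ⟨j + 1, by omega⟩)).Mem p := fun j h =>
    (R.adj_iff _ _ (by simp)).1 ((adj_iff_edge _ _).2 (.inl (.sewing_path i ⟨j, h⟩)))
  choose! m hm using meet
  -- If `m j = m j'`, this point lies on the sewing paths `j` and `j' + 1`, whose indices differ by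
  -- at least two, so that they cannot touch.
  have hinj : ∀ j < k + 1, ∀ j' < k + 1, j < j' → m j ≠ m j' := by
    intro j hj j' hj' hlt h
    have h1 := (eq_of_touch_sewing ⟨m j, (hm j hj).1, h ▸ (hm j' hj').2⟩).2.2
    simp only at h1
    omega
  have hinj' : Set.InjOn m {j | j < k + 1} := by
    intro j hj j' hj' h
    rcases lt_trichotomy j j' with hlt | heq | hlt
    · exact absurd h (hinj j hj j' hj' hlt)
    · exact heq
    · exact absurd h.symm (hinj j' hj' j hj hlt)
  -- The point `m j` is an endpoint of one of the two sewing paths meeting there, and both ends of a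
  -- sewing path lie on the secondary paths.
  have side : ∀ j < k + 1, (R.path (.secondary i.castSucc)).Mem (m j) ∨
      (R.path (.secondary i.succ)).Mem (m j) := by
    intro j hj
    have main : ∀ j' : Fin (k + 2), (R.path (.sewing i j')).IsEndpoint (m j) →
        (R.path (.secondary i.castSucc)).Mem (m j) ∨ (R.path (.secondary i.succ)).Mem (m j) := by
      intro j' he
      obtain ⟨x, hx, hxl⟩ := touch_sewing_left (R := R) i j'
      obtain ⟨y, hy, hyr⟩ := touch_sewing_right (R := R) i j'
      have hxy : x ≠ y := by
        rintro rfl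
        exact not_touch_secondary hne ⟨x, hxl, hyr⟩
      have hx' := hl.isEndpoint_sewing hx hxl
      have hy' := hr.isEndpoint_sewing hy hyr
      obtain h | h : m j = x ∨ m j = y := by
        unfold IsEndpoint at hx' hy' he
        rcases hx' with h1 | h1 <;> rcases hy' with h2 | h2 <;> rcases he with h3 | h3 <;>
          simp_all
      · exact .inl (h ▸ hxl)
      · exact .inr (h ▸ hyr)
    rcases (R.disjoint (.sewing i ⟨j, by omega⟩) (.sewing i ⟨j + 1, by omega⟩) (by simp)).2 (m j)
      (hm j hj).1 (hm j hj).2 with h | h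
    · exact main _ h
    · exact main _ h
  have excl : ∀ p, ¬ ((R.path (.secondary i.castSucc)).Mem p ∧
      (R.path (.secondary i.succ)).Mem p) := fun p hp => not_touch_secondary hne ⟨p, hp.1, hp.2⟩
  let P : ℕ → Prop := fun j => (R.path (.secondary i.castSucc)).Mem (m j)
  -- Sewing path `j + 1` contains both `m j` and `m (j + 1)`, but has only one point on each
  -- secondary path.
  have alt : ∀ j, j + 1 < k + 1 → (P (j + 1) ↔ ¬ P j) := by
    intro j hj
    have hmj := hm j (by omega)
    have hmj' := hm (j + 1) hj
    have hdist := hinj j (by omega) (j + 1) hj (by omega)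
    constructor
    · intro h1 h2
      exact hdist (eq_of_mem_of_mem hl hr hne (touch_sewing_right i _) hmj'.1 h1 hmj.2 h2)
    · intro h
      by_contra h'
      exact hdist (eq_of_mem_of_mem hr hl hne.symm (touch_sewing_left i _) hmj'.1
        ((side _ hj).resolve_left h') hmj.2 ((side j (by omega)).resolve_left h))
  have card : ∀ (Q : ℕ → Prop) [DecidablePred Q],
      (((Finset.range (k + 1)).filter Q).image m).card = Nat.count Q (k + 1) := by
    intro Q _
    rw [Nat.count_eq_card_filter_range]
    refine Finset.card_image_of_injOn fun j hj j' hj' h => ?_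
    simp only [Finset.coe_filter, Finset.mem_range, Set.mem_ofPred_eq] at hj hj'
    exact hinj' hj.1 hj'.1 h
  refine ⟨((Finset.range (k + 1)).filter P).image m, ?_,
    ((Finset.range (k + 1)).filter fun j => ¬ P j).image m, ?_, ?_, ?_, ?_, ?_, ?_⟩
  · intro p hp
    simp only [Finset.mem_image, Finset.mem_filter, Finset.mem_range] at hp
    obtain ⟨j, ⟨hj, hP⟩, rfl⟩ := hp
    exact mem_bendPoints_of_sewing hl hr hne (by simp) (touch_sewing_right i _)
      (touch_sewing_right i _) (hm j hj).1 (hm j hj).2 hP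
  · intro p hp
    simp only [Finset.mem_image, Finset.mem_filter, Finset.mem_range] at hp
    obtain ⟨j, ⟨hj, hP⟩, rfl⟩ := hp
    exact mem_bendPoints_of_sewing hr hl hne.symm (by simp) (touch_sewing_left i _)
      (touch_sewing_left i _) (hm j hj).1 (hm j hj).2 ((side j hj).resolve_left hP)
  · intro p hp
    simp only [Finset.mem_image, Finset.mem_filter, Finset.mem_range] at hp
    obtain ⟨j, ⟨hj, -⟩, rfl⟩ := hp
    exact ⟨_, (hm j hj).1⟩
  · intro p hp
    simp only [Finset.mem_image, Finset.mem_filter, Finset.mem_range] at hp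
    obtain ⟨j, ⟨hj, -⟩, rfl⟩ := hp
    exact ⟨_, (hm j hj).1⟩
  · rw [card, card, Nat.count_eq_card_filter_range, Nat.count_eq_card_filter_range,
      Finset.card_filter_add_card_filter_not, Finset.card_range]
  · rw [card]
    exact two_mul_count_le P (k + 1) alt
  · rw [card]
    exact two_mul_count_le _ (k + 1) fun j hj => by have := alt j hj; tauto

theorem not_isBendCPG : ¬ IsBendCPG k (sewnGraph k) := by
  rintro ⟨R, hR⟩
  obtain ⟨n, hn, good⟩ := exists_four_good (R := R)
  have bound : ∀ (l : Fin 20) (i i' : Fin 19) (S T : Finset (ℤ × ℤ)), i ≠ i' →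
      S ⊆ (R.path (.secondary l)).bendPoints → T ⊆ (R.path (.secondary l)).bendPoints →
      (∀ p ∈ S, ∃ j, (R.path (.sewing i j)).Mem p) →
      (∀ p ∈ T, ∃ j, (R.path (.sewing i' j)).Mem p) → S.card + T.card ≤ k := by
    intro l i i' S T hii hS hT hS' hT'
    -- Sewing paths of different groups do not touch, so no bend serves both groups.
    have hdisj : Disjoint S T := by
      rw [Finset.disjoint_left]
      intro p hp hp'
      obtain ⟨j, hj⟩ := hS' p hp
      obtain ⟨j', hj'⟩ := hT' p hp'
      exact hii (eq_of_touch_sewing ⟨p, hj, hj'⟩).1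
    rw [← Finset.card_union_of_disjoint hdisj]
    exact (Finset.card_le_card (Finset.union_subset hS hT)).trans
      ((card_bendPoints_le _).trans (hR _))
  have gap := fun (m : ℕ) (hm : m < 3) => exists_bendPoints (R := R) ⟨n + m, by omega⟩
    (good m (by omega)) (good (m + 1) (by omega))
  obtain ⟨S₁, -, T₁, hT₁, -, hT₁', h1, h1', -⟩ := gap 0 (by omega)
  obtain ⟨S₂, hS₂, T₂, hT₂, hS₂', hT₂', h2, -, -⟩ := gap 1 (by omega)
  obtain ⟨S₃, hS₃, T₃, -, hS₃', -, h3, -, h3'⟩ := gap 2 (by omega)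
  have b1 := bound _ _ _ T₁ S₂ (by simp) hT₁ hS₂ hT₁' hS₂'
  have b2 := bound _ _ _ T₂ S₃ (by simp) hT₂ hS₃ hT₂' hS₃'
  -- From `h1`, `h1'` and `h3`, `h3'`, both `2 * T₁.card` and `2 * S₃.card` are at least `k`. Adding
  -- `b1` and `b2` and using `h2` gives `k + 1 + T₁.card + S₃.card ≤ 2 * k`, a contradiction.
  omega

end lowerBound
end CPG

/-! ### Upper bound: a representation by staircases -/

namespace CPG

theorem exists_walk_of_fun (n : ℕ) : ∀ (f : ℕ → ℤ × ℤ) (_ : ∀ i < n, grid.Adj (f i) (f (i + 1))),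
    ∃ w : grid.Walk (f 0) (f n), w.length = n ∧ ∀ i ≤ n, w.getVert i = f i := by
  induction n with
  | zero =>
    intro f _
    refine ⟨.nil, rfl, fun i hi => ?_⟩
    obtain rfl : i = 0 := by omega
    rfl
  | succ n ih =>
    intro f h
    obtain ⟨w, hw, hv⟩ := ih (fun i => f (i + 1)) fun i hi => h (i + 1) (by omega)
    refine ⟨.cons (h 0 (by omega)) w, by rw [SimpleGraph.Walk.length_cons, hw], fun i hi => ?_⟩
    cases i with
    | zero => rfl
    | succ i =>
      rw [SimpleGraph.Walk.getVert_cons_succ]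
      exact hv i (by omega)

/-- The path `P` visits the points `g s`, for `s₀ ≤ s ≤ s₁`, in this order. -/
structure IsParam (P : GridPath) (g : ℤ → ℤ × ℤ) (s₀ s₁ : ℤ) : Prop where
  fst_eq : P.fst = g s₀
  lst_eq : P.lst = g s₁
  mem_iff : ∀ p, P.Mem p ↔ ∃ s, s₀ ≤ s ∧ s ≤ s₁ ∧ g s = p

/-- The set `B` records each bend by the parameter just before it: `s ∈ B` allows a bend at `g (s +
1)`. -/
theorem exists_isParam (g : ℤ → ℤ × ℤ) (s₀ s₁ : ℤ) (hs : s₀ < s₁)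
    (hadj : ∀ s, s₀ ≤ s → s < s₁ → grid.Adj (g s) (g (s + 1)))
    (hinj : ∀ s t, s₀ ≤ s → s ≤ s₁ → s₀ ≤ t → t ≤ s₁ → g s = g t → s = t) (B : Finset ℤ)
    (hB : ∀ s, s₀ ≤ s → s + 2 ≤ s₁ → g (s + 2) - g (s + 1) ≠ g (s + 1) - g s → s ∈ B) :
    ∃ P : GridPath, IsParam P g s₀ s₁ ∧ P.bends ≤ B.card := by
  obtain ⟨n, rfl⟩ : ∃ n : ℕ, s₁ = s₀ + n := ⟨(s₁ - s₀).toNat, by omega⟩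
  obtain ⟨w, hw, hv⟩ := exists_walk_of_fun n (fun i => g (s₀ + i)) fun i hi => by
    have := hadj (s₀ + i) (by omega) (by omega)
    simpa [add_assoc] using this
  have hinj' : ∀ i j : ℕ, i ≤ n → j ≤ n → g (s₀ + i) = g (s₀ + j) → i = j := fun i j hi hj h => by
    have := hinj _ _ (by omega) (by omega) (by omega) (by omega) h
    omega
  have hpath : w.IsPath := by
    rw [← SimpleGraph.Walk.IsPath.getVert_injOn_iff]
    intro i hi j hj h
    simp only [Set.mem_ofPred_eq, hw] at hi hj
    rw [hv i hi, hv j hj] at h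
    exact hinj' i j hi hj h
  have hne : g (s₀ + (0 : ℕ)) ≠ g (s₀ + n) := fun h => by
    have := hinj' 0 n (by omega) le_rfl h
    omega
  refine ⟨⟨_, _, w, hpath, hne⟩, ⟨by simp, rfl, fun p => ?_⟩, ?_⟩
  · simp only [GridPath.Mem, SimpleGraph.Walk.mem_support_iff_exists_getVert, hw]
    constructor
    · rintro ⟨i, rfl, hi⟩
      exact ⟨s₀ + i, by omega, by omega, (hv i hi).symm⟩
    · rintro ⟨s, h1, h2, rfl⟩
      refine ⟨(s - s₀).toNat, ?_, by omega⟩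
      rw [hv _ (by omega)]
      congr 1
      omega
  · refine Finset.card_le_card_of_injOn (fun i : ℕ => s₀ + i) ?_ fun i _ j _ h => by simpa using h
    intro i hi
    simp only [Finset.coe_filter, Finset.mem_range, Set.mem_ofPred_eq, hw] at hi
    obtain ⟨hi, hb⟩ := hi
    rw [hv _ (by omega), hv _ (by omega), hv _ (by omega)] at hb
    change s₀ + (i : ℤ) ∈ B
    refine hB _ (by omega) (by omega) ?_
    push_cast at hb
    simpa [add_assoc] using hb

/-- By `unique` the paths have at most one common point, whereas a common grid-edge would give two.
-/
theorem IsParam.interiorlyDisjoint {P Q : GridPath} {g h : ℤ → ℤ × ℤ} {s₀ s₁ t₀ t₁ : ℤ}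
    (hP : IsParam P g s₀ s₁) (hQ : IsParam Q h t₀ t₁)
    (unique : ∀ s t s' t', s₀ ≤ s → s ≤ s₁ → s₀ ≤ s' → s' ≤ s₁ → t₀ ≤ t → t ≤ t₁ → t₀ ≤ t' →
      t' ≤ t₁ → g s = h t → g s' = h t' → s = s')
    (ends : ∀ s t, s₀ ≤ s → s ≤ s₁ → t₀ ≤ t → t ≤ t₁ → g s = h t →
      s = s₀ ∨ s = s₁ ∨ t = t₀ ∨ t = t₁) : P.InteriorlyDisjoint Q := by
  have uniq : ∀ p q, P.Mem p → Q.Mem p → P.Mem q → Q.Mem q → p = q := by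
    simp only [hP.mem_iff, hQ.mem_iff]
    rintro _ _ ⟨s, h1, h2, rfl⟩ ⟨t, h3, h4, h5⟩ ⟨s', h6, h7, rfl⟩ ⟨t', h8, h9, h10⟩
    rw [unique s t s' t' h1 h2 h6 h7 h3 h4 h8 h9 h5.symm h10.symm]
  constructor
  · intro e he he'
    induction e with | h p q =>
    have hpq := P.walk.adj_of_mem_edges he
    refine hpq.ne (uniq p q ?_ ?_ ?_ ?_)
    · exact P.walk.fst_mem_support_of_mem_edges he
    · exact Q.walk.fst_mem_support_of_mem_edges he'
    · exact P.walk.snd_mem_support_of_mem_edges he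
    · exact Q.walk.snd_mem_support_of_mem_edges he'
  · intro p hp hq
    rw [hP.mem_iff] at hp
    rw [hQ.mem_iff] at hq
    obtain ⟨s, h1, h2, rfl⟩ := hp
    obtain ⟨t, h3, h4, h5⟩ := hq
    unfold GridPath.IsEndpoint
    rw [hP.fst_eq, hP.lst_eq, hQ.fst_eq, hQ.lst_eq, ← h5]
    rcases ends s t h1 h2 h3 h4 h5.symm with rfl | rfl | rfl | rfl
    · exact .inl (.inl h5)
    · exact .inl (.inr h5)
    · exact .inr (.inl rfl)
    · exact .inr (.inr rfl)

theorem IsParam.touch_iff {P Q : GridPath} {g h : ℤ → ℤ × ℤ} {s₀ s₁ t₀ t₁ : ℤ}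
    (hP : IsParam P g s₀ s₁) (hQ : IsParam Q h t₀ t₁) :
    P.Touch Q ↔ ∃ s t, s₀ ≤ s ∧ s ≤ s₁ ∧ t₀ ≤ t ∧ t ≤ t₁ ∧ g s = h t := by
  simp only [GridPath.Touch, hP.mem_iff, hQ.mem_iff]
  constructor
  · rintro ⟨_, ⟨s, h1, h2, rfl⟩, t, h3, h4, h5⟩
    exact ⟨s, t, h1, h2, h3, h4, h5.symm⟩
  · rintro ⟨s, t, h1, h2, h3, h4, h5⟩
    exact ⟨_, ⟨s, h1, h2, rfl⟩, t, h3, h4, h5.symm⟩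

theorem GridPath.InteriorlyDisjoint.symm {P Q : GridPath} (h : P.InteriorlyDisjoint Q) :
    Q.InteriorlyDisjoint P :=
  ⟨fun e he he' => h.1 e he' he, fun p hp hq => (h.2 p hq hp).symm⟩

theorem grid_adj_iff (a b c d : ℤ) : grid.Adj (a, b) (c, d) ↔
    (a = c ∧ (b = d + 1 ∨ d = b + 1)) ∨ (b = d ∧ (a = c + 1 ∨ c = a + 1)) := by
  change |a - c| + |b - d| = 1 ↔ _
  rcases abs_cases (a - c) with h1 | h1 <;> rcases abs_cases (b - d) with h2 | h2 <;> omega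

section upperBound

variable (k : ℕ)

/-- The abscissa, on the antidiagonal `x + y = s`, of the path of the first secondary vertex: a
staircase between two straight pieces. -/
def stairs (s : ℤ) : ℤ :=
  if s ≤ 1 then 0
  else if s ≤ k + 2 then s / 2
  else if k % 2 = 0 then s - (k + 2) + (k + 2) / 2
  else (k + 2) / 2

/-- The side of the box containing the representation. -/
def boxSide : ℤ := (k + 1) / 2 + 30

/-- Parametrization of the path of each vertex. -/
def param : Vertex k → ℤ → ℤ × ℤ
  | .a, t => (t, -21)
  | .b, t => (min (2 * boxSide k - t) (boxSide k), min t (boxSide k))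
  | .secondary i, s => (i.val + stairs k s, s - i.val - stairs k s)
  | .sewing i _, s => (i.val + (s + 1) / 2, s - i.val - (s + 1) / 2)

/-- First parameter of the path of each vertex. -/
def paramStart : Vertex k → ℤ
  | .a => -1
  | .b => -21
  | .secondary i => i.val - 21
  | .sewing _ j => j.val

/-- Last parameter of the path of each vertex. -/
def paramEnd : Vertex k → ℤ
  | .a => boxSide k
  | .b => 2 * boxSide k
  | .secondary i => if k % 2 = 0 then k + 31 - i.val else k + 31 + i.val
  | .sewing _ j => j.val + 1

/-- The path of `a` is the bottom side of a box, and that of `b` its right side followed by its top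
side, with one bend at the corner. A secondary path rises from the bottom, bends on the
antidiagonals `1, …, k + 1`, then runs straight to the right side if `k` is even and to the top side
if `k` is odd. The sewing paths are single edges. -/
theorem exists_path (v : Vertex k) :
    ∃ P : GridPath, IsParam P (param k v) (paramStart k v) (paramEnd k v) ∧ P.bends ≤ k + 1 := by
  rcases v with _ | _ | i | ⟨i, j⟩
  · obtain ⟨P, h1, h2⟩ := exists_isParam (param k .a) (paramStart k .a) (paramEnd k .a)
      (by simp only [paramStart, paramEnd, boxSide]; omega)
      (fun s _ _ => (grid_adj_iff _ _ _ _).2 (by omega))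
      (fun s t _ _ _ _ h => by simpa [param] using h) ∅
      (fun s _ _ h => by simp [param] at h)
    exact ⟨P, h1, h2.trans (by simp)⟩
  · obtain ⟨P, h1, h2⟩ := exists_isParam (param k .b) (paramStart k .b) (paramEnd k .b)
      (by simp only [paramStart, paramEnd, boxSide]; omega)
      (fun s _ _ => by
        simp only [param, grid_adj_iff]
        omega)
      (fun s t _ _ _ _ h => by
        simp only [param, Prod.mk.injEq] at h
        omega) {boxSide k - 1}
      (fun s _ _ h => by
        rw [Finset.mem_singleton]
        by_contra hs
        apply h
        simp only [param, Prod.mk_sub_mk, Prod.mk.injEq]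
        omega)
    exact ⟨P, h1, h2.trans (by simp)⟩
  · obtain ⟨P, h1, h2⟩ := exists_isParam (param k (.secondary i)) (paramStart k (.secondary i))
      (paramEnd k (.secondary i))
      (by simp only [paramStart, paramEnd]; split_ifs <;> omega)
      (fun s _ _ => by
        simp only [param, grid_adj_iff, stairs]
        split_ifs <;> omega)
      (fun s t _ _ _ _ h => by
        simp only [param, Prod.mk.injEq] at h
        omega) (Finset.Icc 0 k)
      (fun s _ _ h => by
        rw [Finset.mem_Icc]
        by_contra hs
        apply h
        simp only [param, stairs, Prod.mk_sub_mk, Prod.mk.injEq]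
        split_ifs <;> omega)
    exact ⟨P, h1, h2.trans (by simp)⟩
  · obtain ⟨P, h1, h2⟩ := exists_isParam (param k (.sewing i j)) (paramStart k (.sewing i j))
      (paramEnd k (.sewing i j))
      (by simp only [paramStart, paramEnd]; omega)
      (fun s _ _ => by
        simp only [param, grid_adj_iff]
        omega)
      (fun s t _ _ _ _ h => by
        simp only [param, Prod.mk.injEq] at h
        omega) ∅
      (fun s h1 h2 h => by
        simp only [paramStart, paramEnd] at h1 h2
        omega)
    exact ⟨P, h1, h2.trans (by simp)⟩

variable {k}

/-- The paths with the chosen parametrizations are interiorly disjoint, and touch exactly when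
`adj` holds. -/
def ParamPair (u v : Vertex k) (adj : Prop) : Prop :=
  (∀ s t s' t', paramStart k u ≤ s → s ≤ paramEnd k u → paramStart k u ≤ s' → s' ≤ paramEnd k u →
    paramStart k v ≤ t → t ≤ paramEnd k v → paramStart k v ≤ t' → t' ≤ paramEnd k v →
    param k u s = param k v t → param k u s' = param k v t' → s = s') ∧
  (∀ s t, paramStart k u ≤ s → s ≤ paramEnd k u → paramStart k v ≤ t → t ≤ paramEnd k v →
    param k u s = param k v t →
    (s = paramStart k u ∨ s = paramEnd k u ∨ t = paramStart k v ∨ t = paramEnd k v) ∧ adj) ∧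
  (adj → ∃ s t, paramStart k u ≤ s ∧ s ≤ paramEnd k u ∧ paramStart k v ≤ t ∧ t ≤ paramEnd k v ∧
    param k u s = param k v t)

theorem paramPair_a_b : ParamPair (k := k) .a .b True := by
  simp only [ParamPair, param, paramStart, paramEnd, boxSide, Prod.mk.injEq, and_true]
  exact ⟨fun s t s' t' => by omega, fun s t => by omega,
    fun _ => ⟨(k + 1) / 2 + 30, -21, by omega⟩⟩

theorem paramPair_a_secondary (i : Fin 20) : ParamPair (k := k) .a (.secondary i) True := by
  simp only [ParamPair, param, paramStart, paramEnd, boxSide, stairs, Prod.mk.injEq,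
    and_true]
  refine ⟨fun s t s' t' => ?_, fun s t => ?_, fun _ => ⟨i.val, i.val - 21, ?_⟩⟩
  · split_ifs <;> omega
  · split_ifs <;> omega
  · split_ifs <;> omega

theorem paramPair_b_secondary (i : Fin 20) : ParamPair (k := k) .b (.secondary i) True := by
  simp only [ParamPair, param, paramStart, paramEnd, boxSide, stairs, Prod.mk.injEq, and_true]
  refine ⟨fun s t s' t' => ?_, fun s t => ?_, fun _ => ?_⟩
  · split_ifs <;> omega
  · split_ifs <;> omega
  · rcases Nat.mod_two_eq_zero_or_one k with hk | hk
    -- Even `k`: the contact is on the right side of the box, at height `(k + 2) / 2 - i`.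
    · refine ⟨(k + 2) / 2 - i.val, k + 31 - i.val, ?_⟩
      split_ifs <;> omega
    -- Odd `k`: the contact is on the top side, at abscissa `i + (k + 1) / 2`.
    · refine ⟨(k + 1) / 2 + 60 - i.val, k + 31 + i.val, ?_⟩
      split_ifs <;> omega

/-- The paths are translates along the antidiagonals, so a common point forces equal parameters and
then equal indices. -/
theorem paramPair_secondary_secondary {i i' : Fin 20} (h : i ≠ i') :
    ParamPair (k := k) (.secondary i) (.secondary i') False := by
  rw [Ne, Fin.ext_iff] at h
  simp only [ParamPair, param, Prod.mk.injEq]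
  have key : ∀ s t : ℤ, (i.val : ℤ) + stairs k s = i'.val + stairs k t ∧
      s - i.val - stairs k s = t - i'.val - stairs k t → False := by
    rintro s t ⟨h1, h2⟩
    obtain rfl : s = t := by omega
    omega
  exact ⟨fun s t _ _ _ _ _ _ _ _ _ _ h => (key s t h).elim, fun s t _ _ _ _ h => (key s t h).elim,
    False.elim⟩

theorem paramPair_sewing_a (i : Fin 19) (j : Fin (k + 2)) :
    ParamPair (k := k) (.sewing i j) .a False := by
  simp only [ParamPair, param, paramStart, paramEnd, Prod.mk.injEq]
  exact ⟨fun s t s' t' => by omega, fun s t => by omega, False.elim⟩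

theorem paramPair_sewing_b (i : Fin 19) (j : Fin (k + 2)) :
    ParamPair (k := k) (.sewing i j) .b False := by
  simp only [ParamPair, param, paramStart, paramEnd, boxSide, Prod.mk.injEq]
  exact ⟨fun s t s' t' => by omega, fun s t => by omega, False.elim⟩

theorem stairs_of_le {s : ℤ} (h0 : 0 ≤ s) (h : s ≤ k + 2) : stairs k s = s / 2 := by
  unfold stairs
  split_ifs <;> omega

/-- On the antidiagonal `s` the abscissas are `i + (s + 1) / 2` and `l + s / 2`. They agree for `l =
i` when `s` is even and for `l = i + 1` when `s` is odd; the two parameters `j` and `j + 1` of a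
sewing path include one of each parity. -/
theorem paramPair_sewing_secondary (i : Fin 19) (j : Fin (k + 2)) (l : Fin 20) :
    ParamPair (k := k) (.sewing i j) (.secondary l) (l = i.castSucc ∨ l = i.succ) := by
  simp only [ParamPair, param, paramStart, paramEnd, Prod.mk.injEq, Fin.ext_iff,
    Fin.val_castSucc, Fin.val_succ]
  have key : ∀ s t : ℤ, j.val ≤ s → s ≤ j.val + 1 →
      ((i.val : ℤ) + (s + 1) / 2 = l.val + stairs k t ∧
      s - i.val - (s + 1) / 2 = t - l.val - stairs k t) →
      (i.val : ℤ) + (s + 1) / 2 = l.val + s / 2 := by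
    rintro s t h1 h2 ⟨h3, h4⟩
    obtain rfl : s = t := by omega
    rw [stairs_of_le (by omega) (by omega)] at h3
    exact h3
  refine ⟨fun s t s' t' h1 h2 h3 h4 _ _ _ _ h h' => ?_, fun s t h1 h2 _ _ h => ?_, fun h => ?_⟩
  · have := key s t h1 h2 h
    have := key s' t' h3 h4 h'
    omega
  · have := key s t h1 h2 h
    omega
  · have : ∃ s : ℤ, j.val ≤ s ∧ s ≤ j.val + 1 ∧ (i.val : ℤ) + (s + 1) / 2 = l.val + s / 2 := by
      by_cases hs : (i.val : ℤ) + ((j.val : ℤ) + 1) / 2 = l.val + (j.val : ℤ) / 2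
      · exact ⟨j.val, by omega, by omega, hs⟩
      · exact ⟨j.val + 1, by omega, by omega, by omega⟩
    obtain ⟨s, h1, h2, h3⟩ := this
    refine ⟨s, s, h1, h2, by omega, by split_ifs <;> omega, ?_⟩
    rw [stairs_of_le (by omega) (by omega)]
    omega

theorem paramPair_sewing_sewing {i i' : Fin 19} {j j' : Fin (k + 2)}
    (h : Vertex.sewing i j ≠ .sewing i' j') :
    ParamPair (k := k) (.sewing i j) (.sewing i' j')
      (i' = i ∧ (j'.val = j.val + 1 ∨ j.val = j'.val + 1)) := by
  simp only [ne_eq, Vertex.sewing.injEq, Fin.ext_iff] at h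
  simp only [ParamPair, param, paramStart, paramEnd, Prod.mk.injEq, Fin.ext_iff]
  refine ⟨fun s t s' t' => by omega, fun s t => by omega, fun h' => ?_⟩
  rcases h' with ⟨h1, h2 | h2⟩
  · exact ⟨j'.val, j'.val, by omega⟩
  · exact ⟨j.val, j.val, by omega⟩

theorem isBendCPG_succ : IsBendCPG (k + 1) (sewnGraph k) := by
  choose path hpath hbends using exists_path k
  have spec : ∀ (u v : Vertex k) (adj : Prop), ParamPair u v adj →
      (path u).InteriorlyDisjoint (path v) ∧ (adj ↔ (path u).Touch (path v)) := by
    rintro u v adj ⟨h1, h2, h3⟩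
    refine ⟨(hpath u).interiorlyDisjoint (hpath v) h1 fun s t a b c d h => (h2 s t a b c d h).1, ?_⟩
    rw [(hpath u).touch_iff (hpath v)]
    refine ⟨h3, ?_⟩
    rintro ⟨s, t, a, b, c, d, h⟩
    exact (h2 s t a b c d h).2
  have spec' : ∀ (u v : Vertex k) (adj : Prop), ParamPair v u adj →
      (path u).InteriorlyDisjoint (path v) ∧ (adj ↔ (path u).Touch (path v)) := by
    intro u v adj h
    obtain ⟨h1, h2⟩ := spec v u adj h
    exact ⟨h1.symm, h2.trans ⟨GridPath.Touch.symm, GridPath.Touch.symm⟩⟩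
  have main : ∀ u v : Vertex k, u ≠ v → (path u).InteriorlyDisjoint (path v) ∧
      ((sewnGraph k).Adj u v ↔ (path u).Touch (path v)) := by
    intro u v hne
    rw [adj_iff_edge, edge_iff, edge_iff]
    rcases u with _ | _ | i | ⟨i, j⟩ <;> rcases v with _ | _ | i' | ⟨i', j'⟩
    · exact absurd rfl hne
    · simpa using spec _ _ _ paramPair_a_b
    · simpa using spec _ _ _ (paramPair_a_secondary i')
    · simpa using spec' _ _ _ (paramPair_sewing_a i' j')
    · simpa using spec' _ _ _ paramPair_a_b
    · exact absurd rfl hne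
    · simpa using spec _ _ _ (paramPair_b_secondary i')
    · simpa using spec' _ _ _ (paramPair_sewing_b i' j')
    · simpa using spec' _ _ _ (paramPair_a_secondary i)
    · simpa using spec' _ _ _ (paramPair_b_secondary i)
    · simpa using spec _ _ _ (paramPair_secondary_secondary (by simpa using hne))
    · simpa using spec' _ _ _ (paramPair_sewing_secondary i' j' i)
    · simpa using spec _ _ _ (paramPair_sewing_a i j)
    · simpa using spec _ _ _ (paramPair_sewing_b i j)
    · simpa using spec _ _ _ (paramPair_sewing_secondary i j i')
    · have := spec _ _ _ (paramPair_sewing_sewing hne)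
      rw [and_or_left] at this
      simpa [eq_comm (a := i') (b := i)] using this
  exact ⟨⟨path, fun u v h => (main u v h).1, fun u v h => (main u v h).2⟩, hbends⟩

end upperBound
end CPG

/-! ### Planarity: a straight-line drawing -/

namespace CPG

theorem exists_path_range_eq_segment {x y : ℝ × ℝ} (h : x ≠ y) :
    ∃ γ : Path x y, Function.Injective γ ∧ Set.range γ = segment ℝ x y := by
  refine ⟨⟨⟨fun t => AffineMap.lineMap x y (t : ℝ), by
    exact (AffineMap.lineMap_continuous).comp continuous_subtype_val⟩, by simp, by simp⟩, ?_, ?_⟩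
  · intro s t hst
    exact Subtype.ext (AffineMap.lineMap_injective ℝ h hst)
  · rw [segment_eq_image_lineMap, ← Subtype.range_coe (s := Set.Icc (0 : ℝ) 1), ← Set.range_comp]
    rfl

theorem nat_eq_of_lt_add_one {m n : ℕ} (h1 : (m : ℝ) < n + 1) (h2 : (n : ℝ) < m + 1) : m = n := by
  have h1' : m < n + 1 := by exact_mod_cast h1
  have h2' : n < m + 1 := by exact_mod_cast h2
  omega

section planar

variable {k : ℕ}

/-- The abscissa of the sewing vertices in a straight-line drawing of `G_k`. -/
noncomputable def sewingAbscissa (k j : ℕ) : ℝ := (j + 1) / (100 * (k + 3))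

theorem sewingAbscissa_pos (j : ℕ) : 0 < sewingAbscissa k j := by
  unfold sewingAbscissa; positivity

theorem sewingAbscissa_lt (j : Fin (k + 2)) : sewingAbscissa k j < 1 / 100 := by
  unfold sewingAbscissa
  have : (j : ℝ) < k + 2 := by exact_mod_cast j.isLt
  rw [div_lt_div_iff₀ (by positivity) (by norm_num)]
  linarith

theorem sewingAbscissa_le {j j' : ℕ} : sewingAbscissa k j ≤ sewingAbscissa k j' ↔ j ≤ j' := by
  unfold sewingAbscissa
  rw [div_le_div_iff_of_pos_right (by positivity)]
  simp

theorem sewingAbscissa_inj {j j' : ℕ} (h : sewingAbscissa k j = sewingAbscissa k j') : j = j' :=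
  le_antisymm (sewingAbscissa_le.1 h.le) (sewingAbscissa_le.1 h.ge)

/-- The points representing the vertices in a straight-line drawing of `G_k`. -/
noncomputable def position : Vertex k → ℝ × ℝ
  | .a => (-1, -1)
  | .b => (1, -1)
  | .secondary i => (0, (i.val : ℝ))
  | .sewing i j => (sewingAbscissa k j, i.val + 1 / 2)

theorem mem_segment_iff (a b c d : ℝ) (p : ℝ × ℝ) : p ∈ segment ℝ (a, b) (c, d) ↔
    ∃ s, 0 ≤ s ∧ s ≤ 1 ∧ p.1 = a + s * (c - a) ∧ p.2 = b + s * (d - b) := by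
  rw [segment_eq_image']
  constructor
  · rintro ⟨s, ⟨h0, h1⟩, rfl⟩
    exact ⟨s, h0, h1, by simp, by simp⟩
  · rintro ⟨s, h0, h1, h2, h3⟩
    exact ⟨s, ⟨h0, h1⟩, Prod.ext (by simp [h2]) (by simp [h3])⟩

theorem position_injective : Function.Injective (position (k := k)) := by
  have half (m n : ℕ) : (m : ℝ) ≠ n + 1 / 2 := by
    intro h
    have : m = n := nat_eq_of_lt_add_one (by linarith) (by linarith)
    subst this
    linarith
  rintro (_ | _ | i | ⟨i, j⟩) (_ | _ | i' | ⟨i', j'⟩) h <;>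
    replace h := Prod.ext_iff.1 h <;> simp only [position] at h
  · rfl
  · norm_num at h
  · norm_num at h
  · linarith [h.1, sewingAbscissa_pos (k := k) j']
  · norm_num at h
  · rfl
  · norm_num at h
  · linarith [h.1, sewingAbscissa_lt (k := k) j']
  · norm_num at h
  · norm_num at h
  · rw [Fin.ext (Nat.cast_injective h.2)]
  · exact absurd h.2 (half _ _)
  · linarith [h.1, sewingAbscissa_pos (k := k) j]
  · linarith [h.1, sewingAbscissa_lt (k := k) j]
  · exact absurd h.2.symm (half _ _)
  · rw [Fin.ext (sewingAbscissa_inj h.1), Fin.ext (Nat.cast_injective (add_right_cancel h.2))]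

/-- The straight segments representing `uv` and `u'v'` meet only at common ends. -/
def SegmentsMeetAtEnds (u v u' v' : Vertex k) : Prop :=
  s(u, v) ≠ s(u', v') → ∀ p ∈ segment ℝ (position u) (position v),
    p ∈ segment ℝ (position u') (position v') → ∃ w ∈ s(u, v), w ∈ s(u', v') ∧ position w = p

theorem SegmentsMeetAtEnds.symm {u v u' v' : Vertex k} (h : SegmentsMeetAtEnds u v u' v') :
    SegmentsMeetAtEnds u' v' u v := fun hne p hp hp' =>
  let ⟨w, h1, h2, h3⟩ := h hne.symm p hp' hp
  ⟨w, h2, h1, h3⟩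

section segments

variable {p : ℝ × ℝ}

theorem of_mem_ab (h : p ∈ segment ℝ (position (k := k) .a) (position (k := k) .b)) : p.2 = -1 := by
  simp only [position, mem_segment_iff] at h
  obtain ⟨s, -, -, -, h⟩ := h
  linarith

theorem of_mem_a_secondary {i : Fin 20}
    (h : p ∈ segment ℝ (position (k := k) .a) (position (k := k) (.secondary i))) :
    p.1 ≤ 0 ∧ p.2 = i.val + (i.val + 1) * p.1 := by
  simp only [position, mem_segment_iff] at h
  obtain ⟨s, h0, h1, h2, h3⟩ := h
  refine ⟨by linarith, ?_⟩
  rw [h2, h3]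
  ring

theorem of_mem_b_secondary {i : Fin 20}
    (h : p ∈ segment ℝ (position (k := k) .b) (position (k := k) (.secondary i))) :
    0 ≤ p.1 ∧ p.2 = i.val - (i.val + 1) * p.1 := by
  simp only [position, mem_segment_iff] at h
  obtain ⟨s, h0, h1, h2, h3⟩ := h
  refine ⟨by linarith, ?_⟩
  rw [h2, h3]
  ring

theorem of_mem_sewing_left {i : Fin 19} {j : Fin (k + 2)}
    (h : p ∈ segment ℝ (position (k := k) (.sewing i j)) (position (k := k) (.secondary i.castSucc))) :
    ∃ s, 0 ≤ s ∧ s ≤ 1 ∧ p.1 = sewingAbscissa k j * s ∧ p.2 = i.val + s / 2 := by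
  simp only [position, mem_segment_iff] at h
  obtain ⟨s, h0, h1, h2, h3⟩ := h
  rw [Fin.val_castSucc] at h3
  refine ⟨1 - s, by linarith, by linarith, ?_, ?_⟩
  · rw [h2]; ring
  · rw [h3]; ring

theorem of_mem_sewing_right {i : Fin 19} {j : Fin (k + 2)}
    (h : p ∈ segment ℝ (position (k := k) (.sewing i j)) (position (k := k) (.secondary i.succ))) :
    ∃ s, 0 ≤ s ∧ s ≤ 1 ∧ p.1 = sewingAbscissa k j * s ∧ p.2 = i.val + 1 - s / 2 := by
  simp only [position, mem_segment_iff] at h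
  obtain ⟨s, h0, h1, h2, h3⟩ := h
  rw [Fin.val_succ] at h3
  push_cast at h3
  refine ⟨1 - s, by linarith, by linarith, ?_, ?_⟩
  · rw [h2]; ring
  · rw [h3]; ring

theorem of_mem_sewing_path {i : Fin 19} {j : Fin (k + 1)}
    (h : p ∈ segment ℝ (position (k := k) (.sewing i j.castSucc)) (position (.sewing i j.succ))) :
    sewingAbscissa k j ≤ p.1 ∧ p.1 ≤ sewingAbscissa k (j + 1) ∧ p.2 = i.val + 1 / 2 := by
  simp only [position, mem_segment_iff] at h
  obtain ⟨s, h0, h1, h2, h3⟩ := h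
  rw [Fin.val_castSucc, Fin.val_succ] at h2
  have : sewingAbscissa k j ≤ sewingAbscissa k (j + 1) := sewingAbscissa_le.2 (by omega)
  refine ⟨?_, ?_, ?_⟩
  · nlinarith
  · nlinarith
  · rw [h3]; ring

end segments

theorem meet_ab_a (i : Fin 20) : SegmentsMeetAtEnds (k := k) .a .b .a (.secondary i) := by
  intro _ p hp hp'
  have h1 := of_mem_ab hp
  obtain ⟨-, h2⟩ := of_mem_a_secondary hp'
  have hx : ((i.val : ℝ) + 1) * (p.1 + 1) = 0 := by linarith
  have : p.1 = -1 := by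
    rcases mul_eq_zero.1 hx with h | h
    · exact absurd h (by positivity)
    · linarith
  exact ⟨.a, by simp, by simp, Prod.ext this.symm h1.symm⟩

theorem meet_ab_b (i : Fin 20) : SegmentsMeetAtEnds (k := k) .a .b .b (.secondary i) := by
  intro _ p hp hp'
  have h1 := of_mem_ab hp
  obtain ⟨-, h2⟩ := of_mem_b_secondary hp'
  have hx : ((i.val : ℝ) + 1) * (1 - p.1) = 0 := by linarith
  have : p.1 = 1 := by
    rcases mul_eq_zero.1 hx with h | h
    · exact absurd h (by positivity)
    · linarith
  exact ⟨.b, by simp, by simp, Prod.ext this.symm h1.symm⟩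

theorem meet_ab_of_nonneg {u v : Vertex k}
    (h : ∀ p ∈ segment ℝ (position u) (position v), 0 ≤ p.2) :
    SegmentsMeetAtEnds (k := k) .a .b u v := by
  intro _ p hp hp'
  linarith [of_mem_ab hp, h p hp']

theorem meet_a_a (i i' : Fin 20) :
    SegmentsMeetAtEnds (k := k) .a (.secondary i) .a (.secondary i') := by
  intro hne p hp hp'
  obtain ⟨-, h1⟩ := of_mem_a_secondary hp
  obtain ⟨-, h2⟩ := of_mem_a_secondary hp'
  have hx : ((i.val : ℝ) - i'.val) * (p.1 + 1) = 0 := by linarith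
  rcases mul_eq_zero.1 hx with h | h
  · exact absurd (by rw [Fin.ext (Nat.cast_injective (sub_eq_zero.1 h))]) hne
  · have h3 : p.1 = -1 := by linarith
    exact ⟨.a, by simp, by simp, Prod.ext h3.symm (by rw [h1, h3, position]; ring)⟩

theorem meet_b_b (i i' : Fin 20) :
    SegmentsMeetAtEnds (k := k) .b (.secondary i) .b (.secondary i') := by
  intro hne p hp hp'
  obtain ⟨-, h1⟩ := of_mem_b_secondary hp
  obtain ⟨-, h2⟩ := of_mem_b_secondary hp'
  have hx : ((i.val : ℝ) - i'.val) * (1 - p.1) = 0 := by linarith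
  rcases mul_eq_zero.1 hx with h | h
  · exact absurd (by rw [Fin.ext (Nat.cast_injective (sub_eq_zero.1 h))]) hne
  · have h3 : p.1 = 1 := by linarith
    exact ⟨.b, by simp, by simp, Prod.ext h3.symm (by rw [h1, h3, position]; ring)⟩

theorem meet_a_b (i i' : Fin 20) :
    SegmentsMeetAtEnds (k := k) .a (.secondary i) .b (.secondary i') := by
  intro _ p hp hp'
  obtain ⟨h1, h2⟩ := of_mem_a_secondary hp
  obtain ⟨h3, h4⟩ := of_mem_b_secondary hp'
  have hx : p.1 = 0 := le_antisymm h1 h3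
  rw [hx, mul_zero] at h2 h4
  have hi : i = i' := Fin.ext (Nat.cast_injective (R := ℝ) (by linarith))
  subst hi
  exact ⟨.secondary i, by simp, by simp, Prod.ext hx.symm (by rw [h2, position]; ring)⟩

theorem eq_zero_of_sewing {j : Fin (k + 2)} {x s : ℝ} (hx : x ≤ 0) (hs : 0 ≤ s)
    (h : x = sewingAbscissa k j * s) : s = 0 := by
  by_contra hne
  have : 0 < s := lt_of_le_of_ne hs (Ne.symm hne)
  have := mul_pos (sewingAbscissa_pos (k := k) j) this
  linarith

theorem meet_a_left (i' : Fin 20) (i : Fin 19) (j : Fin (k + 2)) :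
    SegmentsMeetAtEnds .a (.secondary i') (.sewing i j) (.secondary i.castSucc) := by
  intro _ p hp hp'
  obtain ⟨h1, h2⟩ := of_mem_a_secondary hp
  obtain ⟨s, h3, -, h4, h5⟩ := of_mem_sewing_left hp'
  obtain rfl := eq_zero_of_sewing h1 h3 h4
  rw [mul_zero] at h4
  rw [h4] at h2
  have hi : i' = i.castSucc := Fin.ext (Nat.cast_injective (R := ℝ)
    (by rw [Fin.val_castSucc]; linarith))
  subst hi
  exact ⟨.secondary i.castSucc, by simp, by simp, Prod.ext h4.symm (by rw [h2, position]; ring)⟩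

theorem meet_a_right (i' : Fin 20) (i : Fin 19) (j : Fin (k + 2)) :
    SegmentsMeetAtEnds .a (.secondary i') (.sewing i j) (.secondary i.succ) := by
  intro _ p hp hp'
  obtain ⟨h1, h2⟩ := of_mem_a_secondary hp
  obtain ⟨s, h3, -, h4, h5⟩ := of_mem_sewing_right hp'
  obtain rfl := eq_zero_of_sewing h1 h3 h4
  rw [mul_zero] at h4
  rw [h4] at h2
  have hi : i' = i.succ := Fin.ext (Nat.cast_injective (R := ℝ)
    (by rw [Fin.val_succ]; push_cast; linarith))
  subst hi
  exact ⟨.secondary i.succ, by simp, by simp, Prod.ext h4.symm (by rw [h2, position]; ring)⟩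

theorem meet_a_path (i' : Fin 20) (i : Fin 19) (j : Fin (k + 1)) :
    SegmentsMeetAtEnds .a (.secondary i') (.sewing i j.castSucc) (.sewing i j.succ) := by
  intro _ p hp hp'
  linarith [(of_mem_a_secondary hp).1, (of_mem_sewing_path hp').1, sewingAbscissa_pos (k := k) j]

/-- At abscissa `x`, the segment from `b` to the secondary vertex `i` is `(i + 1) * x` below height
`i`. The sewing abscissas are below `1 / 100` so that this drop is less than `1 / 4`, which keeps
the segment above the sewing vertices at height `i - 1 / 2`. -/
theorem slope_bounds (i : Fin 20) (j : Fin (k + 2)) :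
    0 < ((i.val : ℝ) + 1) * sewingAbscissa k j ∧
      ((i.val : ℝ) + 1) * sewingAbscissa k j < 1 / 4 := by
  have h1 := sewingAbscissa_pos (k := k) j
  have h2 := sewingAbscissa_lt (k := k) j
  have h3 : (i.val : ℝ) < 20 := by exact_mod_cast i.isLt
  constructor
  · positivity
  · nlinarith

theorem meet_b_left (i' : Fin 20) (i : Fin 19) (j : Fin (k + 2)) :
    SegmentsMeetAtEnds .b (.secondary i') (.sewing i j) (.secondary i.castSucc) := by
  intro _ p hp hp'
  obtain ⟨-, h2⟩ := of_mem_b_secondary hp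
  obtain ⟨s, h3, h3', h4, h5⟩ := of_mem_sewing_left hp'
  obtain ⟨b1, b2⟩ := slope_bounds i' j
  rw [h4, h5, ← mul_assoc] at h2
  set c := ((i'.val : ℝ) + 1) * sewingAbscissa k j
  -- Comparing heights gives `i' - i = (1 / 2 + c) * s`, which lies in `[0, 3 / 4)`; being an
  -- integer it is `0`, and then `s = 0`.
  have hi : i' = i.castSucc := Fin.ext (nat_eq_of_lt_add_one
    (by rw [Fin.val_castSucc]; nlinarith) (by rw [Fin.val_castSucc]; nlinarith))
  have hs : s = 0 := by
    rw [hi, Fin.val_castSucc] at h2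
    nlinarith
  rw [hs] at h4 h5
  exact ⟨.secondary i.castSucc, by simp [hi], by simp,
    Prod.ext (by rw [h4, position]; ring) (by rw [h5, position, Fin.val_castSucc]; ring)⟩

theorem meet_b_right (i' : Fin 20) (i : Fin 19) (j : Fin (k + 2)) :
    SegmentsMeetAtEnds .b (.secondary i') (.sewing i j) (.secondary i.succ) := by
  intro _ p hp hp'
  obtain ⟨-, h2⟩ := of_mem_b_secondary hp
  obtain ⟨s, h3, h3', h4, h5⟩ := of_mem_sewing_right hp'
  obtain ⟨b1, b2⟩ := slope_bounds i' j
  rw [h4, h5, ← mul_assoc] at h2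
  set c := ((i'.val : ℝ) + 1) * sewingAbscissa k j
  have hi : i' = i.succ := Fin.ext (nat_eq_of_lt_add_one
    (by rw [Fin.val_succ]; push_cast; nlinarith) (by rw [Fin.val_succ]; push_cast; nlinarith))
  have hs : s = 0 := by
    rw [hi, Fin.val_succ] at h2
    push_cast at h2
    nlinarith
  rw [hs] at h4 h5
  exact ⟨.secondary i.succ, by simp [hi], by simp,
    Prod.ext (by rw [h4, position]; ring) (by rw [h5, position, Fin.val_succ]; push_cast; ring)⟩

theorem meet_b_path (i' : Fin 20) (i : Fin 19) (j : Fin (k + 1)) :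
    SegmentsMeetAtEnds .b (.secondary i') (.sewing i j.castSucc) (.sewing i j.succ) := by
  intro _ p hp hp'
  obtain ⟨h1, h2⟩ := of_mem_b_secondary hp
  obtain ⟨h3, h4, h5⟩ := of_mem_sewing_path hp'
  obtain ⟨-, b2⟩ := slope_bounds i' j.succ
  rw [Fin.val_succ] at b2
  have h6 : 0 ≤ ((i'.val : ℝ) + 1) * p.1 := by positivity
  have h7 : ((i'.val : ℝ) + 1) * p.1 < 1 / 4 := lt_of_le_of_lt (by gcongr) b2
  have hi : i'.val = i.val := nat_eq_of_lt_add_one (by linarith) (by linarith)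
  rw [hi] at h2 h6
  linarith

theorem meet_left_left (i i' : Fin 19) (j j' : Fin (k + 2)) :
    SegmentsMeetAtEnds (.sewing i j) (.secondary i.castSucc)
      (.sewing i' j') (.secondary i'.castSucc) := by
  intro hne p hp hp'
  obtain ⟨s, h0, h1, h2, h3⟩ := of_mem_sewing_left hp
  obtain ⟨s', h0', h1', h2', h3'⟩ := of_mem_sewing_left hp'
  obtain rfl : i = i' := Fin.ext (nat_eq_of_lt_add_one (by linarith) (by linarith))
  obtain rfl : s = s' := by linarith
  rcases eq_or_ne s 0 with hs | hs
  · rw [hs] at h2 h3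
    exact ⟨.secondary i.castSucc, by simp, by simp,
      Prod.ext (by rw [h2, position]; ring) (by rw [h3, position, Fin.val_castSucc]; ring)⟩
  · have := sewingAbscissa_inj (mul_right_cancel₀ hs (h2.symm.trans h2'))
    exact absurd (by rw [Fin.ext this]) hne

theorem meet_right_right (i i' : Fin 19) (j j' : Fin (k + 2)) :
    SegmentsMeetAtEnds (.sewing i j) (.secondary i.succ) (.sewing i' j') (.secondary i'.succ) := by
  intro hne p hp hp'
  obtain ⟨s, h0, h1, h2, h3⟩ := of_mem_sewing_right hp
  obtain ⟨s', h0', h1', h2', h3'⟩ := of_mem_sewing_right hp'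
  obtain rfl : i = i' := Fin.ext (nat_eq_of_lt_add_one (by linarith) (by linarith))
  obtain rfl : s = s' := by linarith
  rcases eq_or_ne s 0 with hs | hs
  · rw [hs] at h2 h3
    exact ⟨.secondary i.succ, by simp, by simp, Prod.ext (by rw [h2, position]; ring)
      (by rw [h3, position, Fin.val_succ]; push_cast; ring)⟩
  · have := sewingAbscissa_inj (mul_right_cancel₀ hs (h2.symm.trans h2'))
    exact absurd (by rw [Fin.ext this]) hne

theorem meet_left_right (i i' : Fin 19) (j j' : Fin (k + 2)) :
    SegmentsMeetAtEnds (.sewing i j) (.secondary i.castSucc)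
      (.sewing i' j') (.secondary i'.succ) := by
  intro _ p hp hp'
  obtain ⟨s, h0, h1, h2, h3⟩ := of_mem_sewing_left hp
  obtain ⟨s', h0', h1', h2', h3'⟩ := of_mem_sewing_right hp'
  -- The first segment covers heights `i` to `i + 1 / 2`, the second `i' + 1 / 2` to `i' + 1`. They
  -- can meet only at a secondary vertex, if `i = i' + 1`, or at a sewing vertex, if `i = i'`.
  by_cases hii : i.val = i'.val + 1
  · have hs : s = 0 := by rw [hii] at h3; push_cast at h3; linarith
    rw [hs] at h2 h3
    have : i.castSucc = i'.succ := Fin.ext hii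
    exact ⟨.secondary i.castSucc, by simp, by simp [this],
      Prod.ext (by rw [h2, position]; ring) (by rw [h3, position, Fin.val_castSucc]; ring)⟩
  · have hle : i.val ≤ i'.val + 1 := by
      have : (i.val : ℝ) ≤ i'.val + 1 := by linarith
      exact_mod_cast this
    have hlt : (i.val : ℝ) < i'.val + 1 := by exact_mod_cast lt_of_le_of_ne hle hii
    obtain rfl : i = i' := Fin.ext (nat_eq_of_lt_add_one hlt (by
      have : i'.val ≤ i.val := by
        have : (i'.val : ℝ) ≤ i.val := by linarith
        exact_mod_cast this
      exact_mod_cast Nat.lt_succ_of_le this))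
    have hs : s = 1 := by linarith
    have hs' : s' = 1 := by linarith
    rw [hs] at h2 h3
    rw [hs'] at h2'
    obtain rfl : j = j' := Fin.ext (sewingAbscissa_inj (by linarith))
    exact ⟨.sewing i j, by simp, by simp,
      Prod.ext (by rw [h2, position]; ring) (by rw [h3, position])⟩

theorem exists_mem_path {i : Fin 19} {j : Fin (k + 2)} {j' : Fin (k + 1)}
    (h1 : sewingAbscissa k j' ≤ sewingAbscissa k j)
    (h2 : sewingAbscissa k j ≤ sewingAbscissa k (j' + 1)) :
    Vertex.sewing i j ∈ s(Vertex.sewing i j'.castSucc, .sewing i j'.succ) := by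
  rw [sewingAbscissa_le] at h1 h2
  rw [Sym2.mem_iff, Vertex.sewing.injEq, Vertex.sewing.injEq, Fin.ext_iff (a := j), Fin.ext_iff (a := j),
    Fin.val_castSucc, Fin.val_succ]
  rcases Nat.lt_or_ge j'.val j.val with h | h
  · exact .inr ⟨rfl, by omega⟩
  · exact .inl ⟨rfl, by omega⟩

theorem meet_left_path (i i' : Fin 19) (j : Fin (k + 2)) (j' : Fin (k + 1)) :
    SegmentsMeetAtEnds (.sewing i j) (.secondary i.castSucc)
      (.sewing i' j'.castSucc) (.sewing i' j'.succ) := by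
  intro _ p hp hp'
  obtain ⟨s, h0, h1, h2, h3⟩ := of_mem_sewing_left hp
  obtain ⟨h4, h5, h6⟩ := of_mem_sewing_path hp'
  obtain rfl : i = i' := Fin.ext (nat_eq_of_lt_add_one (by linarith) (by linarith))
  have hs : s = 1 := by linarith
  rw [hs, mul_one] at h2
  rw [h2] at h4 h5
  exact ⟨.sewing i j, by simp, exists_mem_path h4 h5, Prod.ext h2.symm h6.symm⟩

theorem meet_right_path (i i' : Fin 19) (j : Fin (k + 2)) (j' : Fin (k + 1)) :
    SegmentsMeetAtEnds (.sewing i j) (.secondary i.succ)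
      (.sewing i' j'.castSucc) (.sewing i' j'.succ) := by
  intro _ p hp hp'
  obtain ⟨s, h0, h1, h2, h3⟩ := of_mem_sewing_right hp
  obtain ⟨h4, h5, h6⟩ := of_mem_sewing_path hp'
  obtain rfl : i = i' := Fin.ext (nat_eq_of_lt_add_one (by linarith) (by linarith))
  have hs : s = 1 := by linarith
  rw [hs, mul_one] at h2
  rw [h2] at h4 h5
  exact ⟨.sewing i j, by simp, exists_mem_path h4 h5, Prod.ext h2.symm h6.symm⟩

theorem meet_path_path (i i' : Fin 19) (j j' : Fin (k + 1)) :
    SegmentsMeetAtEnds (k := k) (.sewing i j.castSucc) (.sewing i j.succ)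
      (.sewing i' j'.castSucc) (.sewing i' j'.succ) := by
  intro hne p hp hp'
  obtain ⟨h1, h2, h3⟩ := of_mem_sewing_path hp
  obtain ⟨h4, h5, h6⟩ := of_mem_sewing_path hp'
  obtain rfl : i = i' := Fin.ext (nat_eq_of_lt_add_one (by linarith) (by linarith))
  have h7 : j.val ≤ j'.val + 1 := sewingAbscissa_le.1 (h1.trans h5)
  have h8 : j'.val ≤ j.val + 1 := sewingAbscissa_le.1 (h4.trans h2)
  rcases lt_trichotomy j.val j'.val with h | h | h
  · have e : j.val + 1 = j'.val := by omega
    have e' : j'.castSucc = j.succ := Fin.ext e.symm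
    rw [e] at h2
    exact ⟨.sewing i j.succ, by simp, by simp [e'],
      Prod.ext (by rw [position, Fin.val_succ, e]; exact le_antisymm h4 h2) h3.symm⟩
  · exact absurd (by rw [Fin.ext h]) hne
  · have e : j'.val + 1 = j.val := by omega
    have e' : j.castSucc = j'.succ := Fin.ext e.symm
    rw [e] at h5
    exact ⟨.sewing i j'.succ, by simp [e'], by simp,
      Prod.ext (by rw [position, Fin.val_succ, e]; exact le_antisymm h1 h5) h3.symm⟩

theorem segmentsMeetAtEnds {u v u' v' : Vertex k} (h : Edge k u v) (h' : Edge k u' v') :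
    SegmentsMeetAtEnds u v u' v' := by
  have ab_left (i : Fin 19) (j : Fin (k + 2)) :
      SegmentsMeetAtEnds .a .b (.sewing i j) (.secondary i.castSucc) :=
    meet_ab_of_nonneg fun p hp => by
      obtain ⟨s, h0, -, -, h⟩ := of_mem_sewing_left hp
      rw [h]; positivity
  have ab_right (i : Fin 19) (j : Fin (k + 2)) :
      SegmentsMeetAtEnds .a .b (.sewing i j) (.secondary i.succ) :=
    meet_ab_of_nonneg fun p hp => by
      obtain ⟨s, -, h0, -, h⟩ := of_mem_sewing_right hp
      have : (0 : ℝ) ≤ i.val := by positivity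
      linarith
  have ab_path (i : Fin 19) (j : Fin (k + 1)) :
      SegmentsMeetAtEnds (k := k) .a .b (.sewing i j.castSucc) (.sewing i j.succ) :=
    meet_ab_of_nonneg fun p hp => by
      rw [(of_mem_sewing_path hp).2.2]; positivity
  cases h <;> cases h'
  case ab.ab => exact fun h => absurd rfl h
  case ab.a_secondary => exact meet_ab_a _
  case ab.b_secondary => exact meet_ab_b _
  case ab.sewing_left => exact ab_left _ _
  case ab.sewing_right => exact ab_right _ _
  case ab.sewing_path => exact ab_path _ _
  case a_secondary.ab => exact (meet_ab_a _).symm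
  case a_secondary.a_secondary => exact meet_a_a _ _
  case a_secondary.b_secondary => exact meet_a_b _ _
  case a_secondary.sewing_left => exact meet_a_left _ _ _
  case a_secondary.sewing_right => exact meet_a_right _ _ _
  case a_secondary.sewing_path => exact meet_a_path _ _ _
  case b_secondary.ab => exact (meet_ab_b _).symm
  case b_secondary.a_secondary => exact (meet_a_b _ _).symm
  case b_secondary.b_secondary => exact meet_b_b _ _
  case b_secondary.sewing_left => exact meet_b_left _ _ _
  case b_secondary.sewing_right => exact meet_b_right _ _ _
  case b_secondary.sewing_path => exact meet_b_path _ _ _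
  case sewing_left.ab => exact (ab_left _ _).symm
  case sewing_left.a_secondary => exact (meet_a_left _ _ _).symm
  case sewing_left.b_secondary => exact (meet_b_left _ _ _).symm
  case sewing_left.sewing_left => exact meet_left_left _ _ _ _
  case sewing_left.sewing_right => exact meet_left_right _ _ _ _
  case sewing_left.sewing_path => exact meet_left_path _ _ _ _
  case sewing_right.ab => exact (ab_right _ _).symm
  case sewing_right.a_secondary => exact (meet_a_right _ _ _).symm
  case sewing_right.b_secondary => exact (meet_b_right _ _ _).symm
  case sewing_right.sewing_left => exact (meet_left_right _ _ _ _).symm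
  case sewing_right.sewing_right => exact meet_right_right _ _ _ _
  case sewing_right.sewing_path => exact meet_right_path _ _ _ _
  case sewing_path.ab => exact (ab_path _ _).symm
  case sewing_path.a_secondary => exact (meet_a_path _ _ _).symm
  case sewing_path.b_secondary => exact (meet_b_path _ _ _).symm
  case sewing_path.sewing_left => exact (meet_left_path _ _ _ _).symm
  case sewing_path.sewing_right => exact (meet_right_path _ _ _ _).symm
  case sewing_path.sewing_path => exact meet_path_path _ _ _ _

/-- The segment representing an edge in the straight-line drawing of `G_k`. -/
noncomputable def edgeSegment : Sym2 (Vertex k) → Set (ℝ × ℝ) :=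
  Sym2.lift ⟨fun u v => segment ℝ (position u) (position v), fun _ _ => segment_symm ℝ _ _⟩

theorem exists_edge_eq {e : Sym2 (Vertex k)} (he : e ∈ (sewnGraph k).edgeSet) :
    ∃ u v, Edge k u v ∧ e = s(u, v) := by
  induction e with | h u v =>
  rw [SimpleGraph.mem_edgeSet, adj_iff_edge] at he
  rcases he with he | he
  · exact ⟨u, v, he, rfl⟩
  · exact ⟨v, u, he, Sym2.eq_swap⟩

theorem edgeSegment_inter (e : Sym2 (Vertex k)) (he : e ∈ (sewnGraph k).edgeSet)
    (f : Sym2 (Vertex k)) (hf : f ∈ (sewnGraph k).edgeSet) (hne : e ≠ f) (x : ℝ × ℝ)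
    (hx : x ∈ edgeSegment e) (hx' : x ∈ edgeSegment f) : ∃ w, w ∈ e ∧ w ∈ f ∧ position w = x := by
  obtain ⟨u, v, h, rfl⟩ := exists_edge_eq he
  obtain ⟨u', v', h', rfl⟩ := exists_edge_eq hf
  exact segmentsMeetAtEnds h h' hne x hx hx'

theorem exists_edge_mem (w : Vertex k) : ∃ e ∈ (sewnGraph k).edgeSet, w ∈ e := by
  rcases w with _ | _ | i | ⟨i, j⟩
  · exact ⟨s(.a, .b), (adj_iff_edge _ _).2 (.inl .ab), by simp⟩
  · exact ⟨s(.a, .b), (adj_iff_edge _ _).2 (.inl .ab), by simp⟩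
  · exact ⟨s(.a, .secondary i), (adj_iff_edge _ _).2 (.inl (.a_secondary i)), by simp⟩
  · exact ⟨s(.sewing i j, .secondary i.castSucc), (adj_iff_edge _ _).2 (.inl (.sewing_left i j)),
      by simp⟩

theorem position_mem_edgeSegment {e : Sym2 (Vertex k)} {w : Vertex k} (h : w ∈ e) :
    position w ∈ edgeSegment e := by
  induction e with | h u v =>
  rcases Sym2.mem_iff.1 h with rfl | rfl
  · exact left_mem_segment ℝ _ _
  · exact right_mem_segment ℝ _ _

theorem isPlanar_sewnGraph : IsPlanar (sewnGraph k) := by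
  refine ⟨⟨position, edgeSegment, position_injective, fun u v h =>
    exists_path_range_eq_segment (position_injective.ne h.ne), fun e he w hw => ?_,
    edgeSegment_inter⟩⟩
  -- Every vertex is an end of some edge `f`, so a vertex lying on the segment of `e` is a common
  -- point of `e` and `f`, to which the intersection property applies.
  obtain ⟨f, hf, hwf⟩ := exists_edge_mem w
  by_cases hef : e = f
  · rwa [hef]
  · obtain ⟨w', h1, -, h3⟩ := edgeSegment_inter e he f hf hef _ hw (position_mem_edgeSegment hwf)
    rwa [← position_injective h3]

end planar
end CPG

/-- For every `k`, the graph `G_k` is planar, is `B_{k+1}`-CPG, and is not `B_k`-CPG. -/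
theorem theorem1 (k : ℕ) :
    CPG.IsPlanar (CPG.sewnGraph k) ∧
      CPG.IsBendCPG (k + 1) (CPG.sewnGraph k) ∧
      ¬ CPG.IsBendCPG k (CPG.sewnGraph k) :=
  ⟨CPG.isPlanar_sewnGraph, CPG.isBendCPG_succ, CPG.not_isBendCPG⟩
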